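/- Let $\mathcal H$ be a separable complex Hilbert space and $\mathcal F_b(\mathcal H)=\bigoplus_{k\ge 0}\mathcal H^{\otimes_s k}$ its bosonic Fock space, with elements $\psi=(\psi^{(k)})_{k\ge0}$. For $g\in\mathcal H$ let $a(g)$, $a^\dagger(g)$ be the (closed) annihilation and creation operators, given on symmetric tensors by $a(g)\Omega=0$, $a^\dagger(g)\Omega=g$ and $$a(g)(f_1\otimes_s\cdots\otimes_s f_k)=\tfrac1{\sqrt k}\sum_{i}\langle g,f_i\rangle f_1\otimes_s\cdots\widehat{f_i}\cdots\otimes_s f_k,\qquad a^\dagger(g)(f_1\otimes_s\cdots\otimes_s f_k)=\sqrt{k+1}\,g\otimes_s f_1\otimes_s\cdots\otimes_s f_k ,$$ let $\varphi(g)=\overline{a(g)+a^\dagger(g)}$, let $\Gamma(-1)$ be multiplication by $(-1)^k$ on $\mathcal H^{\otimes_s k}$, and for $\omega$ selfadjoint on $\mathcal H$ let $d\Gamma(\omega)$ be its second quantisation, i.e. the direct sum over $k$ of the restrictions to $\mathcal H^{\otimes_s k}$ of the closures of $\sum_{j=1}^k 1\otimes\cdots\otimes\omega\otimes\cdots\otimes1$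 ($\omega$ in the $j$-th factor). For $n\in\mathbb N$, $\eta\in\mathbb C$, $\alpha\in\mathbb C^{2n}$, $f\in\mathcal H^{2n}$ define, on their natural domains (sums on the intersection of the domains, powers and products wherever they are defined, $S\otimes T$ the closure of the algebraic tensor product), $$H_\eta(\alpha,f,\omega)=\eta\,\sigma_z\otimes1+1\otimes d\Gamma(\omega)+\sum_{i=1}^{2n}\alpha_i(\sigma_x\otimes\varphi(f_i))^i\quad\text{on }\mathbb C^2\otimes\mathcal F_b(\mathcal H),$$ $$F_\eta(\alpha,f,\omega)=\eta\,\Gamma(-1)+d\Gamma(\omega)+\sum_{i=1}^{2n}\alpha_i\varphi(f_i)^i\quad\text{on }\mathcal F_b(\mathcal H),$$ where $\sigma_x,\sigma_z$ are the Pauli matrices. Identify $\mathbb C^2\otimes\mathcal F_b(\mathcal H)$ with $\mathcal F_b(\mathcal H)\oplus\mathcal F_b(\mathcal H)$ by $e_1\otimes\phi_1+e_{-1}\otimes\phi_{-1}\leftrightarrow(\phi_1,\phi_{-1})$, where $e_1=(1,0)$, $e_{-1}=(0,1)$. For $\phi=(\phi_1,\phi_{-1})\in\mathcal F_b(\mathcal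 H)\oplus\mathcal F_b(\mathcal H)$ and $j\in\{1,-1\}$ let $\widetilde\phi_j^{(k)}=\phi_j^{(k)}$ if $k$ is even and $\widetilde\phi_j^{(k)}=\phi_{-j}^{(k)}$ if $k$ is odd. Then $\widetilde\phi_j=(\widetilde\phi_j^{(k)})_{k\ge 0}\in\mathcal F_b(\mathcal H)$, and the map $U:\phi\mapsto(\widetilde\phi_1,\widetilde\phi_{-1})$ is a bounded linear operator on $\mathcal F_b(\mathcal H)\oplus\mathcal F_b(\mathcal H)$ that is selfadjoint and unitary. Moreover, for all $n\in\mathbb N$, $\eta\in\mathbb C$, $\alpha\in\mathbb C^{2n}$, $f\in\mathcal H^{2n}$ and all selfadjoint operators $\omega$ on $\mathcal H$, $$U\,H_\eta(\alpha,f,\omega)\,U^*=F_\eta(\alpha,f,\omega)\oplus F_{-\eta}(\alpha,f,\omega)$$ as unbounded operators, including equality of the domains. -/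

import Mathlib

open scoped TensorProduct ComplexConjugate ComplexOrder

noncomputable section

namespace SpinBoson

/-- The algebraic `n`-fold tensor power `H ⊗ ⋯ ⊗ H`. A separate name, because it is to carry the
Hilbert space inner product and not the projective seminorm. -/
def AlgTensor (H : Type*) [NormedAddCommGroup H] [InnerProductSpace ℂ H] (n : ℕ) : Type _ :=
  PiTensorProduct ℂ (fun _ : Fin n => H)

section AlgTensor

variable {H : Type*} [NormedAddCommGroup H] [InnerProductSpace ℂ H] {n m : ℕ}

instance : AddCommGroup (AlgTensor H n) :=
  inferInstanceAs (AddCommGroup (PiTensorProduct ℂ (fun _ : Fin n => H)))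

instance : Module ℂ (AlgTensor H n) :=
  inferInstanceAs (Module ℂ (PiTensorProduct ℂ (fun _ : Fin n => H)))

/-- The elementary tensor `x₁ ⊗ ⋯ ⊗ xₙ` in the algebraic tensor power. -/
def algTprod (n : ℕ) : MultilinearMap ℂ (fun _ : Fin n => H) (AlgTensor H n) :=
  PiTensorProduct.tprod ℂ

/-- The universal property of the algebraic tensor power. -/
def algLift {E : Type*} [AddCommGroup E] [Module ℂ E]
    (φ : MultilinearMap ℂ (fun _ : Fin n => H) E) : AlgTensor H n →ₗ[ℂ] E :=
  PiTensorProduct.lift φ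

@[simp] theorem algLift_tprod {E : Type*} [AddCommGroup E] [Module ℂ E]
    (φ : MultilinearMap ℂ (fun _ : Fin n => H) E) (x : Fin n → H) :
    algLift φ (algTprod n x) = φ x :=
  PiTensorProduct.lift.tprod x

theorem span_algTprod : Submodule.span ℂ (Set.range (algTprod (H := H) n)) = ⊤ :=
  PiTensorProduct.span_tprod_eq_top

theorem algTensor_induction {p : AlgTensor H n → Prop} (t : AlgTensor H n)
    (h1 : ∀ x, p (algTprod n x)) (h2 : ∀ s t, p s → p t → p (s + t))
    (h3 : ∀ (c : ℂ) t, p t → p (c • t)) : p t := by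
  have ht : t ∈ Submodule.span ℂ (Set.range (algTprod (H := H) n)) := by
    rw [span_algTprod]; trivial
  induction ht using Submodule.span_induction with
  | mem t ht => obtain ⟨x, rfl⟩ := ht; exact h1 x
  | zero => simpa using h3 0 _ (h1 0)
  | add s t _ _ hs ht => exact h2 s t hs ht
  | smul c t _ ht => exact h3 c t ht

/-- The functional `y₁ ⊗ ⋯ ⊗ yₙ ↦ ∏ i, ⟪xᵢ, yᵢ⟫`. -/
def innerFunctional (x : Fin n → H) : AlgTensor H n →ₗ[ℂ] ℂ :=
  algLift ((MultilinearMap.mkPiAlgebra ℂ (Fin n) ℂ).compLinearMap fun i => innerₛₗ ℂ (x i))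

@[simp] theorem innerFunctional_tprod (x y : Fin n → H) :
    innerFunctional x (algTprod n y) = ∏ i, inner ℂ (x i) (y i) := by
  simp [innerFunctional]

/-- For fixed `t`, the multilinear map `x ↦ ⟪t, x₁ ⊗ ⋯ ⊗ xₙ⟫`. -/
def innerMultilinear (t : AlgTensor H n) : MultilinearMap ℂ (fun _ : Fin n => H) ℂ where
  toFun x := conj (innerFunctional x t)
  map_update_add' := by
    intro _ x i a b
    induction t using algTensor_induction with
    | h1 y =>
      simp only [innerFunctional_tprod, map_prod, inner_conj_symm]
      exact ((MultilinearMap.mkPiAlgebra ℂ (Fin n) ℂ).compLinearMap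
        fun i => innerₛₗ ℂ (y i)).map_update_add x i a b
    | h2 s t hs ht => simp only [map_add, hs, ht]; ring
    | h3 c t ht => simp only [map_smul, smul_eq_mul, map_mul, ht]; ring
  map_update_smul' := by
    intro _ x i c a
    induction t using algTensor_induction with
    | h1 y =>
      simp only [innerFunctional_tprod, map_prod, inner_conj_symm]
      exact ((MultilinearMap.mkPiAlgebra ℂ (Fin n) ℂ).compLinearMap
        fun i => innerₛₗ ℂ (y i)).map_update_smul x i c a
    | h2 s t hs ht => simp only [map_add, hs, ht, smul_add]
    | h3 d t ht => simp only [map_smul, smul_eq_mul, map_mul, ht]; ring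

/-- The inner product of the algebraic tensor power,
`⟪x₁ ⊗ ⋯ ⊗ xₙ, y₁ ⊗ ⋯ ⊗ yₙ⟫ = ∏ i, ⟪xᵢ, yᵢ⟫`. -/
def algInner (s t : AlgTensor H n) : ℂ := algLift (innerMultilinear s) t

@[simp] theorem algInner_tprod (x y : Fin n → H) :
    algInner (algTprod n x) (algTprod n y) = ∏ i, inner ℂ (x i) (y i) := by
  simp [algInner, innerMultilinear, map_prod, inner_conj_symm]

theorem algInner_add_right (s t u : AlgTensor H n) :
    algInner s (t + u) = algInner s t + algInner s u := map_add _ _ _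

theorem algInner_smul_right (s t : AlgTensor H n) (c : ℂ) :
    algInner s (c • t) = c * algInner s t := map_smul _ _ _

theorem algInner_add_left (s t u : AlgTensor H n) :
    algInner (s + t) u = algInner s u + algInner t u := by
  induction u using algTensor_induction with
  | h1 y => simp [algInner, innerMultilinear]
  | h2 u v hu hv => simp only [algInner_add_right, hu, hv]; ring
  | h3 c u hu => simp only [algInner_smul_right, hu]; ring

theorem algInner_smul_left (s t : AlgTensor H n) (c : ℂ) :
    algInner (c • s) t = conj c * algInner s t := by
  induction t using algTensor_induction with
  | h1 y => simp [algInner, innerMultilinear]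
  | h2 u v hu hv => simp only [algInner_add_right, hu, hv]; ring
  | h3 c u hu => simp only [algInner_smul_right, hu]; ring

theorem algInner_conj_symm (s t : AlgTensor H n) : conj (algInner t s) = algInner s t := by
  induction s using algTensor_induction with
  | h1 x =>
    induction t using algTensor_induction with
    | h1 y => simp [map_prod, inner_conj_symm]
    | h2 u v hu hv => simp only [algInner_add_right, algInner_add_left, map_add, hu, hv]
    | h3 c u hu => simp only [algInner_smul_right, algInner_smul_left, map_mul, hu, Complex.conj_conj]
  | h2 u v hu hv => simp only [algInner_add_right, algInner_add_left, map_add, hu, hv]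
  | h3 c u hu => simp only [algInner_smul_right, algInner_smul_left, map_mul, hu]

theorem posSemidef_prod_gram {ι : Type*} [Finite ι] (v : ι → Fin n → H) :
    (Matrix.of fun a b : ι => ∏ i, inner ℂ (v a i) (v b i)).PosSemidef := by
  have key : ∀ s : Finset (Fin n),
      (Matrix.of fun a b : ι => ∏ i ∈ s, inner ℂ (v a i) (v b i)).PosSemidef := by
    intro s
    induction s using Finset.induction_on with
    | empty =>
      have e : (Matrix.of fun a b : ι => ∏ i ∈ (∅ : Finset (Fin n)), inner ℂ (v a i) (v b i))
          = Matrix.gram ℂ (fun _ : ι => (1 : ℂ)) := by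
        ext a b
        simp
      rw [e]
      exact Matrix.posSemidef_gram (𝕜 := ℂ) _
    | insert j s hj ih =>
      have e : (Matrix.of fun a b : ι => ∏ i ∈ insert j s, inner ℂ (v a i) (v b i))
          = (Matrix.gram ℂ (fun a : ι => v a j)).hadamard
            (Matrix.of fun a b : ι => ∏ i ∈ s, inner ℂ (v a i) (v b i)) := by
        ext a b
        simp [Finset.prod_insert hj]
      rw [e]
      exact (Matrix.posSemidef_gram (𝕜 := ℂ) _).hadamard ih
  exact key Finset.univ

theorem algInner_sum_right {k : ℕ} (c : Fin k → ℂ) (w : Fin k → AlgTensor H n)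
    (u : AlgTensor H n) : algInner u (∑ a, c a • w a) = ∑ a, c a * algInner u (w a) := by
  simp only [algInner, map_sum, map_smul, smul_eq_mul]

theorem algInner_sum_left {k : ℕ} (c : Fin k → ℂ) (w : Fin k → AlgTensor H n)
    (u : AlgTensor H n) : algInner (∑ a, c a • w a) u = ∑ a, conj (c a) * algInner (w a) u := by
  rw [← algInner_conj_symm, algInner_sum_right, map_sum]
  refine Finset.sum_congr rfl fun a _ => ?_
  rw [map_mul, algInner_conj_symm]

theorem algInner_self_nonneg (t : AlgTensor H n) : 0 ≤ (algInner t t).re := by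
  have ht : t ∈ Submodule.span ℂ (Set.range (algTprod (H := H) n)) := by
    rw [span_algTprod]; trivial
  obtain ⟨k, c, g, rfl⟩ := Submodule.mem_span_set'.1 ht
  choose v hv using fun a => (g a).2
  have h := (posSemidef_prod_gram v).dotProduct_mulVec_nonneg c
  have e : algInner (∑ a, c a • (g a : AlgTensor H n)) (∑ a, c a • (g a : AlgTensor H n))
      = star c ⬝ᵥ ((Matrix.of fun a b => ∏ i, inner ℂ (v a i) (v b i)).mulVec c) := by
    rw [algInner_sum_left]
    refine Finset.sum_congr rfl fun a _ => ?_
    rw [algInner_sum_right]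
    simp only [Pi.star_apply, starRingEnd_apply, Matrix.mulVec, dotProduct, Matrix.of_apply]
    congr 1
    refine Finset.sum_congr rfl fun b _ => ?_
    rw [← hv a, ← hv b, algInner_tprod, mul_comm]
  rw [e]
  exact (Complex.le_def.1 h).1

/-- The inner product on the algebraic tensor power. -/
@[reducible] def algCore (H : Type*) [NormedAddCommGroup H] [InnerProductSpace ℂ H] (n : ℕ) :
    PreInnerProductSpace.Core ℂ (AlgTensor H n) where
  inner := algInner
  conj_inner_symm := algInner_conj_symm
  re_inner_nonneg := algInner_self_nonneg
  add_left := algInner_add_left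
  smul_left s t c := algInner_smul_left s t c

instance : SeminormedAddCommGroup (AlgTensor H n) :=
  letI := algCore H n
  InnerProductSpace.Core.toSeminormedAddCommGroup (𝕜 := ℂ)

instance : InnerProductSpace ℂ (AlgTensor H n) := InnerProductSpace.ofCore (algCore H n)

@[simp] theorem inner_algTprod (x y : Fin n → H) :
    inner ℂ (algTprod n x) (algTprod n y) = ∏ i, inner ℂ (x i) (y i) := algInner_tprod x y

/-- Two linear maps between inner product spaces agree in all inner products as soon as they
do so on elementary tensors. -/
theorem inner_map_eq_of_tprod (L : AlgTensor H n →ₗ[ℂ] AlgTensor H m) (c : ℂ)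
    (h : ∀ x y, inner ℂ (L (algTprod n x)) (L (algTprod n y)) =
      c * inner ℂ (algTprod n x) (algTprod n y)) (s t : AlgTensor H n) :
    inner ℂ (L s) (L t) = c * inner ℂ s t := by
  induction s using algTensor_induction with
  | h1 x =>
    induction t using algTensor_induction with
    | h1 y => exact h x y
    | h2 u v hu hv => simp only [map_add, inner_add_right, hu, hv]; ring
    | h3 d u hu => simp only [map_smul, inner_smul_right, hu]; ring
  | h2 u v hu hv => simp only [map_add, inner_add_left, hu, hv]; ring
  | h3 d u hu => simp only [map_smul, inner_smul_left, hu]; ring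

end AlgTensor

section HilbertTensor

variable {H : Type*} [NormedAddCommGroup H] [InnerProductSpace ℂ H] {n m : ℕ}

theorem norm_map_of_tprod (L : AlgTensor H n →ₗ[ℂ] AlgTensor H m) (c : ℝ) (hc : 0 ≤ c)
    (h : ∀ x y, inner ℂ (L (algTprod n x)) (L (algTprod n y)) =
      ((c ^ 2 : ℝ) : ℂ) * inner ℂ (algTprod n x) (algTprod n y)) (t : AlgTensor H n) :
    ‖L t‖ = c * ‖t‖ := by
  have e := inner_map_eq_of_tprod L _ h t t
  rw [inner_self_eq_norm_sq_to_K, inner_self_eq_norm_sq_to_K] at e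
  have e' : ‖L t‖ ^ 2 = (c * ‖t‖) ^ 2 := by
    rw [mul_pow]
    have e2 : ((‖L t‖ ^ 2 : ℝ) : ℂ) = ((c ^ 2 * ‖t‖ ^ 2 : ℝ) : ℂ) := by
      push_cast at e ⊢
      exact e
    exact Complex.ofReal_injective e2
  exact (pow_left_inj₀ (norm_nonneg _) (by positivity) two_ne_zero).1 e'

/-- The permutation of the tensor factors, `x₁ ⊗ ⋯ ⊗ xₙ ↦ x_{σ 1} ⊗ ⋯ ⊗ x_{σ n}`. -/
def algPerm (σ : Equiv.Perm (Fin n)) : AlgTensor H n →L[ℂ] AlgTensor H n :=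
  (algLift ((algTprod n).domDomCongr σ)).mkContinuous 1 fun t =>
    (norm_map_of_tprod _ 1 zero_le_one (fun x y => by
      simpa using Equiv.prod_comp σ fun i => inner ℂ (x i) (y i)) t).le

@[simp] theorem algPerm_tprod (σ : Equiv.Perm (Fin n)) (x : Fin n → H) :
    algPerm σ (algTprod n x) = algTprod n (fun i => x (σ i)) := by
  simp [algPerm]

/-- Tensoring with `g` from the left, `x₁ ⊗ ⋯ ⊗ xₙ ↦ g ⊗ x₁ ⊗ ⋯ ⊗ xₙ`. -/
def algTensorLeft (n : ℕ) (g : H) : AlgTensor H n →L[ℂ] AlgTensor H (n + 1) :=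
  (algLift ((algTprod (H := H) (n + 1)).curryLeft g)).mkContinuous ‖g‖ fun t =>
    (norm_map_of_tprod _ ‖g‖ (norm_nonneg g) (fun x y => by
      simp [Fin.prod_univ_succ, inner_self_eq_norm_sq_to_K]) t).le

@[simp] theorem algTensorLeft_tprod (g : H) (x : Fin n → H) :
    algTensorLeft n g (algTprod n x) = algTprod (n + 1) (Fin.cons g x : Fin (n + 1) → H) := by
  simp [algTensorLeft]

/-- The tensor power of an isometry, `x₁ ⊗ ⋯ ⊗ xₙ ↦ V x₁ ⊗ ⋯ ⊗ V xₙ`. -/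
def algMap (n : ℕ) (V : H →ₗᵢ[ℂ] H) : AlgTensor H n →L[ℂ] AlgTensor H n :=
  (algLift ((algTprod n).compLinearMap fun _ => V.toLinearMap)).mkContinuous 1 fun t =>
    (norm_map_of_tprod _ 1 zero_le_one (fun x y => by simp) t).le

@[simp] theorem algMap_tprod (V : H →ₗᵢ[ℂ] H) (x : Fin n → H) :
    algMap n V (algTprod n x) = algTprod n (fun i => V (x i)) := by
  simp [algMap]

/-- The `n`-fold Hilbert space tensor power: the completion of the algebraic one. -/
abbrev TensorPower (H : Type*) [NormedAddCommGroup H] [InnerProductSpace ℂ H] (n : ℕ) : Type _ :=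
  UniformSpace.Completion (AlgTensor H n)

/-- The elementary tensor `x₁ ⊗ ⋯ ⊗ xₙ`. -/
def tprod (x : Fin n → H) : TensorPower H n := (algTprod n x : AlgTensor H n)

/-- The permutation of the tensor factors, `x₁ ⊗ ⋯ ⊗ xₙ ↦ x_{σ 1} ⊗ ⋯ ⊗ x_{σ n}`. -/
def perm (σ : Equiv.Perm (Fin n)) : TensorPower H n →L[ℂ] TensorPower H n :=
  (algPerm σ).completion

/-- Tensoring with `g` from the left, `ψ ↦ g ⊗ ψ`. -/
def tensorLeft (n : ℕ) (g : H) : TensorPower H n →L[ℂ] TensorPower H (n + 1) :=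
  (algTensorLeft n g).completion

/-- The tensor power `V ⊗ ⋯ ⊗ V` of an isometry. -/
def tensorMap (n : ℕ) (V : H →ₗᵢ[ℂ] H) : TensorPower H n →L[ℂ] TensorPower H n :=
  (algMap n V).completion

/-- The contraction with `g` in the first factor,
`x₁ ⊗ x₂ ⊗ ⋯ ⊗ xₙ₊₁ ↦ ⟪g, x₁⟫ x₂ ⊗ ⋯ ⊗ xₙ₊₁`, as the adjoint of `ψ ↦ g ⊗ ψ`. -/
def contract (n : ℕ) (g : H) : TensorPower H (n + 1) →L[ℂ] TensorPower H n :=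
  (tensorLeft n g).adjoint

@[simp] theorem inner_tprod (x y : Fin n → H) :
    inner ℂ (tprod x) (tprod y) = ∏ i, inner ℂ (x i) (y i) := by
  simp [tprod]

@[simp] theorem perm_tprod (σ : Equiv.Perm (Fin n)) (x : Fin n → H) :
    perm σ (tprod x) = tprod (fun i => x (σ i)) := by
  simp [perm, tprod]

@[simp] theorem tensorLeft_tprod (g : H) (x : Fin n → H) :
    tensorLeft n g (tprod x) = tprod (Fin.cons g x : Fin (n + 1) → H) := by
  simp [tensorLeft, tprod]

@[simp] theorem tensorMap_tprod (V : H →ₗᵢ[ℂ] H) (x : Fin n → H) :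
    tensorMap n V (tprod x) = tprod (fun i => V (x i)) := by
  simp [tensorMap, tprod]

theorem dense_span_tprod :
    (Submodule.span ℂ (Set.range (tprod (H := H) (n := n)))).topologicalClosure = ⊤ := by
  have e : Submodule.span ℂ (Set.range (tprod (H := H) (n := n))) =
      LinearMap.range (UniformSpace.Completion.toComplL (𝕜 := ℂ) (E := AlgTensor H n)).toLinearMap := by
    rw [LinearMap.range_eq_map, ← span_algTprod, Submodule.map_span, ← Set.range_comp]
    rfl
  rw [e, ← Submodule.dense_iff_topologicalClosure_eq_top]
  exact UniformSpace.Completion.denseRange_coe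

/-- Continuous linear maps on the tensor power that agree on elementary tensors are equal. -/
theorem clm_ext {E : Type*} [NormedAddCommGroup E] [NormedSpace ℂ E]
    {L M : TensorPower H n →L[ℂ] E} (h : ∀ x, L (tprod x) = M (tprod x)) : L = M := by
  refine ContinuousLinearMap.ext_on (s := Set.range (tprod (H := H) (n := n))) ?_ ?_
  · have := dense_span_tprod (H := H) (n := n)
    exact Submodule.dense_iff_topologicalClosure_eq_top.2 this
  · rintro _ ⟨x, rfl⟩
    exact h x

@[simp] theorem contract_tprod (g : H) (x : Fin (n + 1) → H) :
    contract n g (tprod x) = inner ℂ g (x 0) • tprod (fun i => x i.succ) := by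
  refine ext_inner_left ℂ fun v => ?_
  have : (innerSL ℂ (contract n g (tprod x))) = innerSL ℂ (inner ℂ g (x 0) • tprod (fun i => x i.succ)) := by
    refine clm_ext fun y => ?_
    simp [contract, ContinuousLinearMap.adjoint_inner_left, Fin.prod_univ_succ]
  have h2 := congrArg (fun L => conj (L v)) this
  simpa using h2

theorem perm_perm (σ τ : Equiv.Perm (Fin n)) (ψ : TensorPower H n) :
    perm σ (perm τ ψ) = perm (τ * σ) ψ := by
  have : (perm σ).comp (perm τ) = perm (H := H) (τ * σ) := clm_ext fun x => by simp
  exact congrArg (fun L => L ψ) this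

theorem contract_perm (g : H) (σ : Equiv.Perm (Fin n)) (ψ : TensorPower H (n + 1)) :
    perm σ (contract n g ψ) = contract n g (perm (Equiv.Perm.decomposeFin.symm (0, σ)) ψ) := by
  have : (perm σ).comp (contract n g)
      = (contract n g).comp (perm (H := H) (Equiv.Perm.decomposeFin.symm (0, σ))) :=
    clm_ext fun x => by simp
  exact congrArg (fun L => L ψ) this

theorem perm_tensorMap (V : H →ₗᵢ[ℂ] H) (σ : Equiv.Perm (Fin n)) (ψ : TensorPower H n) :
    perm σ (tensorMap n V ψ) = tensorMap n V (perm σ ψ) := by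
  have : (perm σ).comp (tensorMap n V) = (tensorMap n V).comp (perm (H := H) σ) :=
    clm_ext fun x => by simp
  exact congrArg (fun L => L ψ) this

/-- The symmetric tensors: those invariant under all permutations of the factors. -/
def SymTensor (H : Type*) [NormedAddCommGroup H] [InnerProductSpace ℂ H] (n : ℕ) :
    Submodule ℂ (TensorPower H n) where
  carrier := {ψ | ∀ σ : Equiv.Perm (Fin n), perm σ ψ = ψ}
  add_mem' ha hb σ := by rw [map_add, ha σ, hb σ]
  zero_mem' σ := map_zero _
  smul_mem' c a ha σ := by rw [map_smul, ha σ]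

instance : CompleteSpace (SymTensor H n) := by
  have : IsClosed (SymTensor H n : Set (TensorPower H n)) := by
    have e : (SymTensor H n : Set (TensorPower H n)) =
        ⋂ σ : Equiv.Perm (Fin n), {ψ | perm σ ψ = ψ} := by
      ext ψ
      simp [SymTensor]
    rw [e]
    exact isClosed_iInter fun σ => isClosed_eq (perm σ).continuous continuous_id
  exact this.completeSpace_coe

/-- The symmetrization `(1 / n!) ∑ σ, perm σ`, the projection onto the symmetric tensors. -/
def symmetrize (n : ℕ) : TensorPower H n →L[ℂ] SymTensor H n :=
  (((n.factorial : ℂ)⁻¹) • ∑ σ : Equiv.Perm (Fin n), perm σ).codRestrict (SymTensor H n) <| by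
    intro ψ τ
    simp only [_root_.smul_apply, _root_.sum_apply, map_smul, map_sum,
      perm_perm]
    congr 1
    exact Fintype.sum_equiv (Equiv.mulRight τ) _ _ fun σ => rfl

/-- The symmetric tensor product `x₁ ⊗ₛ ⋯ ⊗ₛ xₙ`. -/
def symTprod (x : Fin n → H) : SymTensor H n := symmetrize n (tprod x)

/-- The creation operator from `n` to `n + 1` particles,
`a†(g) (f₁ ⊗ₛ ⋯ ⊗ₛ fₙ) = √(n+1) g ⊗ₛ f₁ ⊗ₛ ⋯ ⊗ₛ fₙ`. -/
def creationComp (n : ℕ) (g : H) : SymTensor H n →L[ℂ] SymTensor H (n + 1) :=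
  (Real.sqrt (n + 1) : ℂ) •
    (symmetrize (n + 1) ∘L tensorLeft n g ∘L (SymTensor H n).subtypeL)

/-- The annihilation operator from `n + 1` to `n` particles,
`a(g) (f₁ ⊗ₛ ⋯ ⊗ₛ fₙ₊₁) = (n+1)^(-1/2) ∑ i, ⟪g, fᵢ⟫ f₁ ⊗ₛ ⋯ (omit fᵢ) ⋯ ⊗ₛ fₙ₊₁`.
On symmetric tensors this is `√(n+1)` times the contraction with `g` in the first factor. -/
def annihilationComp (n : ℕ) (g : H) : SymTensor H (n + 1) →L[ℂ] SymTensor H n :=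
  (Real.sqrt (n + 1) : ℂ) •
    (contract n g ∘L (SymTensor H (n + 1)).subtypeL).codRestrict (SymTensor H n) (by
      intro ψ σ
      simp only [ContinuousLinearMap.comp_apply, contract_perm]
      congr 1
      exact ψ.2 _)

/-- The `n`-particle component `V ⊗ ⋯ ⊗ V` of `Γ(V)`, for an isometry `V`. -/
def gammaComp (n : ℕ) (V : H →ₗᵢ[ℂ] H) : SymTensor H n →L[ℂ] SymTensor H n :=
  (tensorMap n V ∘L (SymTensor H n).subtypeL).codRestrict (SymTensor H n) (by
    intro ψ σ
    simp only [ContinuousLinearMap.comp_apply, perm_tensorMap]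
    congr 1
    exact ψ.2 _)

theorem coe_symmetrize (ψ : TensorPower H n) :
    (symmetrize n ψ : TensorPower H n) =
      ((n.factorial : ℂ)⁻¹) • ∑ σ : Equiv.Perm (Fin n), perm σ ψ := by
  change (((n.factorial : ℂ)⁻¹) • ∑ σ : Equiv.Perm (Fin n), perm (H := H) σ) ψ = _
  simp

theorem symmetrize_perm (τ : Equiv.Perm (Fin n)) (ψ : TensorPower H n) :
    symmetrize n (perm τ ψ) = symmetrize n ψ := by
  apply Subtype.ext
  rw [coe_symmetrize, coe_symmetrize]
  congr 1
  simp only [perm_perm]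
  exact Fintype.sum_equiv (Equiv.mulLeft τ) _ _ fun σ => rfl

theorem creationComp_symTprod (g : H) (f : Fin n → H) :
    creationComp n g (symTprod f) =
      (Real.sqrt (n + 1) : ℂ) • symTprod (Fin.cons g f : Fin (n + 1) → H) := by
  have h : ∀ σ : Equiv.Perm (Fin n), symmetrize (n + 1) (tensorLeft n g (perm σ (tprod f)))
      = symTprod (Fin.cons g f : Fin (n + 1) → H) := by
    intro σ
    rw [symTprod, ← symmetrize_perm (Equiv.Perm.decomposeFin.symm (0, σ)) (tprod (Fin.cons g f)),
      perm_tprod, perm_tprod, tensorLeft_tprod]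
    congr 2
    funext i
    refine Fin.cases ?_ (fun j => ?_) i <;> simp
  change (Real.sqrt (n + 1) : ℂ) • symmetrize (n + 1) (tensorLeft n g (symTprod f)) = _
  congr 1
  rw [symTprod, coe_symmetrize, map_smul, map_smul, map_sum, map_sum,
    Finset.sum_congr rfl fun σ _ => h σ, Finset.sum_const, Finset.card_univ, Fintype.card_perm,
    Fintype.card_fin, ← Nat.cast_smul_eq_nsmul ℂ, smul_smul,
    inv_mul_cancel₀ (by exact_mod_cast n.factorial_ne_zero), one_smul]

theorem annihilationComp_symTprod (g : H) (f : Fin (n + 1) → H) :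
    annihilationComp n g (symTprod f) =
      ((Real.sqrt (n + 1) : ℂ)⁻¹) •
        ∑ i, inner ℂ g (f i) • symTprod (fun j => f (i.succAbove j)) := by
  have h : ∀ i : Fin (n + 1),
      ∑ σ : Equiv.Perm (Fin n), tprod (fun j => f (Equiv.swap 0 i (σ j).succ))
        = (n.factorial : ℂ) • (symTprod (fun j => f (i.succAbove j)) : TensorPower H n) := by
    intro i
    have hne : ∀ j : Fin n, Equiv.swap 0 i j.succ ≠ i := fun j hj => by
      have : j.succ = 0 := by
        apply (Equiv.swap 0 i).injective
        rw [hj, Equiv.swap_apply_left]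
      exact Fin.succ_ne_zero j this
    choose r hr using fun j => Fin.exists_succAbove_eq (hne j)
    have hinj : Function.Injective r := fun a b hab => by
      have : Equiv.swap 0 i a.succ = Equiv.swap 0 i b.succ := by rw [← hr, ← hr, hab]
      exact Fin.succ_injective _ ((Equiv.swap 0 i).injective this)
    let ρ : Equiv.Perm (Fin n) := Equiv.ofBijective r (Finite.injective_iff_bijective.1 hinj)
    have hρ : ∀ j, i.succAbove (ρ j) = Equiv.swap 0 i j.succ := hr
    rw [symTprod, ← symmetrize_perm ρ, coe_symmetrize, smul_smul,
      mul_inv_cancel₀ (by exact_mod_cast n.factorial_ne_zero), one_smul]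
    refine Finset.sum_congr rfl fun σ _ => ?_
    rw [perm_tprod, perm_tprod]
    simp only [hρ]
  have hn : (Real.sqrt (n + 1) : ℂ) ≠ 0 := by
    exact_mod_cast (Real.sqrt_pos.2 (by positivity : (0 : ℝ) < n + 1)).ne'
  have hs : (Real.sqrt (n + 1) : ℂ) * (Real.sqrt (n + 1) : ℂ) = n + 1 := by
    exact_mod_cast Real.mul_self_sqrt (by positivity : (0 : ℝ) ≤ n + 1)
  have hf : (n.factorial : ℂ) ≠ 0 := by exact_mod_cast n.factorial_ne_zero
  apply Subtype.ext
  change (Real.sqrt (n + 1) : ℂ) • contract n g (symTprod f : TensorPower H (n + 1)) = _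
  rw [symTprod, coe_symmetrize, map_smul, map_sum,
    ← Equiv.sum_comp Equiv.Perm.decomposeFin.symm, Fintype.sum_prod_type]
  simp only [perm_tprod, contract_tprod, Equiv.Perm.decomposeFin_symm_apply_zero,
    Equiv.Perm.decomposeFin_symm_apply_succ, ← Finset.smul_sum, h]
  simp only [Submodule.coe_smul, Submodule.coe_sum, Finset.smul_sum, smul_smul]
  refine Finset.sum_congr rfl fun i _ => ?_
  congr 1
  rw [Nat.factorial_succ]
  push_cast
  rw [← hs]
  field_simp

end HilbertTensor

section Operators

variable {E F G : Type*} [AddCommGroup E] [Module ℂ E] [AddCommGroup F] [Module ℂ F]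
  [AddCommGroup G] [Module ℂ G]

/-- The product `S T` of unbounded operators on its natural domain `{x ∈ D(T) | T x ∈ D(S)}`. -/
def opComp (S : F →ₗ.[ℂ] G) (T : E →ₗ.[ℂ] F) : E →ₗ.[ℂ] G where
  domain :=
    { carrier := {x | ∃ h : x ∈ T.domain, T ⟨x, h⟩ ∈ S.domain}
      add_mem' := by
        rintro x y ⟨hx, hx'⟩ ⟨hy, hy'⟩
        refine ⟨add_mem hx hy, ?_⟩
        have := T.map_add ⟨x, hx⟩ ⟨y, hy⟩
        exact this ▸ add_mem hx' hy'
      zero_mem' := ⟨zero_mem _, by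
        have := T.map_zero
        exact this ▸ zero_mem _⟩
      smul_mem' := by
        rintro c x ⟨hx, hx'⟩
        refine ⟨Submodule.smul_mem _ c hx, ?_⟩
        have := T.map_smul c ⟨x, hx⟩
        exact this ▸ Submodule.smul_mem _ c hx' }
  toFun :=
    { toFun := fun x => S ⟨T ⟨x.1, x.2.1⟩, x.2.2⟩
      map_add' := fun x y => by
        rw [← S.map_add]
        congr 1
        exact Subtype.ext (T.map_add ⟨x.1, x.2.1⟩ ⟨y.1, y.2.1⟩)
      map_smul' := fun c x => by
        rw [RingHom.id_apply, ← S.map_smul]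
        congr 1
        exact Subtype.ext (T.map_smul c ⟨x.1, x.2.1⟩) }

/-- An everywhere defined linear map as an operator. -/
def everywhere (T : E →ₗ[ℂ] F) : E →ₗ.[ℂ] F := T.toPMap ⊤

/-- The powers `Tⁱ` of an unbounded operator on their natural domains. -/
def opPow (T : E →ₗ.[ℂ] E) : ℕ → E →ₗ.[ℂ] E
  | 0 => everywhere LinearMap.id
  | i + 1 => opComp T (opPow T i)

/-- The operator `V T W`, with domain `{x | W x ∈ D(T)}`. -/
def sandwich (V : E →ₗ[ℂ] F) (T : E →ₗ.[ℂ] E) (W : F →ₗ[ℂ] E) : F →ₗ.[ℂ] F :=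
  opComp (everywhere V) (opComp T (everywhere W))

/-- The direct sum `S ⊕ T` on the Hilbert space `E ⊕ F`, with domain `D(S) ⊕ D(T)`. -/
def opProd (S : E →ₗ.[ℂ] E) (T : F →ₗ.[ℂ] F) :
    WithLp 2 (E × F) →ₗ.[ℂ] WithLp 2 (E × F) where
  domain :=
    { carrier := {x | x.fst ∈ S.domain ∧ x.snd ∈ T.domain}
      add_mem' := fun hx hy => ⟨add_mem hx.1 hy.1, add_mem hx.2 hy.2⟩
      zero_mem' := ⟨zero_mem _, zero_mem _⟩
      smul_mem' := fun c _ hx => ⟨Submodule.smul_mem _ c hx.1, Submodule.smul_mem _ c hx.2⟩ }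
  toFun :=
    { toFun := fun x => WithLp.toLp 2 (S ⟨x.1.fst, x.2.1⟩, T ⟨x.1.snd, x.2.2⟩)
      map_add' := fun x y => by
        rw [← WithLp.toLp_add, Prod.mk_add_mk, ← S.map_add, ← T.map_add]
        rfl
      map_smul' := fun c x => by
        rw [RingHom.id_apply, ← WithLp.toLp_smul, Prod.smul_mk, ← S.map_smul, ← T.map_smul]
        rfl }

end Operators

section Fock

variable (H : Type*) [NormedAddCommGroup H] [InnerProductSpace ℂ H]

/-- The bosonic Fock space, the Hilbert space direct sum of the symmetric tensor powers. The
component `ψ⁽ⁿ⁾` of `ψ` is `ψ n`. -/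
abbrev Fock : Type _ := lp (fun n : ℕ => SymTensor H n) 2

variable {H}

/-- An operator that is given by a linear map into sequences of components, on its maximal domain
in Fock space: all `ψ` for which the resulting sequence is square summable. -/
def maximalOp (C : Fock H →ₗ[ℂ] ((n : ℕ) → SymTensor H n)) : Fock H →ₗ.[ℂ] Fock H where
  domain :=
    { carrier := {ψ | Memℓp (C ψ) 2}
      add_mem' := fun {x y} hx hy => by
        change Memℓp (C (x + y)) 2
        rw [map_add]
        exact Memℓp.add hx hy
      zero_mem' := by
        change Memℓp (C 0) 2
        rw [map_zero]
        exact zero_memℓp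
      smul_mem' := fun c x hx => by
        change Memℓp (C (c • x)) 2
        rw [map_smul]
        exact Memℓp.const_smul hx c }
  toFun :=
    { toFun := fun ψ => ⟨C ψ.1, ψ.2⟩
      map_add' := fun x y => Subtype.ext (map_add C x.1 y.1)
      map_smul' := fun c x => Subtype.ext (map_smul C c x.1) }

/-- The annihilation operator, `(a(g) ψ)⁽ⁿ⁾ = a(g) ψ⁽ⁿ⁺¹⁾` on its maximal domain. -/
def annihilation (g : H) : Fock H →ₗ.[ℂ] Fock H :=
  maximalOp
    { toFun := fun ψ n => annihilationComp n g (ψ (n + 1))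
      map_add' := fun x y => by ext1 n; exact map_add _ _ _
      map_smul' := fun c x => by ext1 n; exact (annihilationComp n g).map_smul c (x (n + 1)) }

/-- The creation operator, `(a†(g) ψ)⁽⁰⁾ = 0` and `(a†(g) ψ)⁽ⁿ⁺¹⁾ = a†(g) ψ⁽ⁿ⁾` on its maximal
domain. -/
def creation (g : H) : Fock H →ₗ.[ℂ] Fock H :=
  maximalOp
    { toFun := fun ψ n => match n with
        | 0 => 0
        | n + 1 => creationComp n g (ψ n)
      map_add' := fun x y => by
        ext1 n
        cases n with
        | zero => exact (add_zero _).symm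
        | succ n => exact map_add _ _ _
      map_smul' := fun c x => by
        ext1 n
        cases n with
        | zero => exact (smul_zero c).symm
        | succ n => exact (creationComp n g).map_smul c (x n) }

/-- The field operator `φ(g)`, the closure of `a(g) + a†(g)`. -/
def fieldOp (g : H) : Fock H →ₗ.[ℂ] Fock H := (annihilation g + creation g).closure

/-- The direct sum of operators `T n` on the `n`-particle spaces, with domain
`{ψ | ψ⁽ⁿ⁾ ∈ D(T n) for all n, ∑ ‖T n ψ⁽ⁿ⁾‖² < ∞}`. -/
def fockDirectSum (T : (n : ℕ) → SymTensor H n →ₗ.[ℂ] SymTensor H n) :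
    Fock H →ₗ.[ℂ] Fock H where
  domain :=
    { carrier := {ψ | ∃ h : ∀ n, ψ n ∈ (T n).domain, Memℓp (fun n => T n ⟨ψ n, h n⟩) 2}
      add_mem' := by
        rintro x y ⟨hx, hx'⟩ ⟨hy, hy'⟩
        refine ⟨fun n => add_mem (hx n) (hy n), ?_⟩
        have e : (fun n => T n ⟨(x + y) n, add_mem (hx n) (hy n)⟩)
            = (fun n => T n ⟨x n, hx n⟩) + fun n => T n ⟨y n, hy n⟩ := by
          ext1 n
          exact (T n).map_add ⟨x n, hx n⟩ ⟨y n, hy n⟩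
        exact e ▸ hx'.add hy'
      zero_mem' := by
        refine ⟨fun n => zero_mem _, ?_⟩
        have e : (fun n => T n ⟨(0 : Fock H) n, zero_mem _⟩) = 0 := by
          ext1 n
          exact (T n).map_zero
        exact e ▸ zero_memℓp
      smul_mem' := by
        rintro c x ⟨hx, hx'⟩
        refine ⟨fun n => Submodule.smul_mem _ c (hx n), ?_⟩
        have e : (fun n => T n ⟨(c • x) n, Submodule.smul_mem _ c (hx n)⟩)
            = c • fun n => T n ⟨x n, hx n⟩ := by
          ext1 n
          exact (T n).map_smul c ⟨x n, hx n⟩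
        exact e ▸ hx'.const_smul c }
  toFun :=
    { toFun := fun ψ => ⟨fun n => T n ⟨ψ.1 n, ψ.2.1 n⟩, ψ.2.2⟩
      map_add' := fun x y => by
        refine Subtype.ext (funext fun n => ?_)
        exact (T n).map_add ⟨x.1 n, x.2.1 n⟩ ⟨y.1 n, y.2.1 n⟩
      map_smul' := fun c x => by
        refine Subtype.ext (funext fun n => ?_)
        exact (T n).map_smul c ⟨x.1 n, x.2.1 n⟩ }

/-- The second quantisation `Γ(V)` of an isometry. -/
def gamma (V : H →ₗᵢ[ℂ] H) : Fock H →ₗ.[ℂ] Fock H :=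
  fockDirectSum fun n => everywhere (gammaComp n V).toLinearMap

/-- The graph of `∑ k, 1 ⊗ ⋯ ⊗ A ⊗ ⋯ ⊗ 1` (with `A` in the `k`-th factor) on the algebraic tensor
power of the domain of `A`. -/
def sumGraph (n : ℕ) (A : H →ₗ.[ℂ] H) : Submodule ℂ (TensorPower H n × TensorPower H n) :=
  Submodule.span ℂ (Set.range fun x : Fin n → A.domain =>
    (tprod fun i => (x i : H),
      ∑ k, tprod (Function.update (fun i => (x i : H)) k (A (x k)))))

/-- The `n`-particle component of `dΓ(A)`: the restriction to the symmetric tensors of the closure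
of `∑ k, 1 ⊗ ⋯ ⊗ A ⊗ ⋯ ⊗ 1`. For `n = 0` this is the zero operator. -/
def secondQuantComp (n : ℕ) (A : H →ₗ.[ℂ] H) : SymTensor H n →ₗ.[ℂ] SymTensor H n :=
  ((sumGraph n A).topologicalClosure.comap
    ((SymTensor H n).subtype.prodMap (SymTensor H n).subtype)).toLinearPMap

/-- The second quantisation `dΓ(A)`. -/
def secondQuant (A : H →ₗ.[ℂ] H) : Fock H →ₗ.[ℂ] Fock H :=
  fockDirectSum fun n => secondQuantComp n A

end Fock

theorem continuous_tprod {H : Type*} [NormedAddCommGroup H] [InnerProductSpace ℂ H] (n : ℕ) :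
    Continuous (tprod : (Fin n → H) → TensorPower H n) := by
  have h : ∀ x : Fin n → H, ‖algTprod n x‖ ≤ 1 * ∏ i, ‖x i‖ := fun x => by
    have e : ‖algTprod n x‖ ^ 2 = (∏ i, ‖x i‖) ^ 2 := by
      have := inner_algTprod x x
      simp only [inner_self_eq_norm_sq_to_K] at this
      rw [← Finset.prod_pow]
      apply Complex.ofReal_injective
      push_cast at this ⊢
      exact this
    rw [one_mul]
    exact ((pow_left_inj₀ (norm_nonneg _) (Finset.prod_nonneg fun i _ => norm_nonneg _)
      two_ne_zero).1 e).le
  exact (UniformSpace.Completion.continuous_coe _).comp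
    ((algTprod (H := H) n).continuous_of_bound 1 h)

/-- For selfadjoint `A` the closure of `sumGraph n A` is the graph of an operator, so that
`secondQuantComp` is given by it. -/
theorem sumGraph_closure_functional {H : Type*} [NormedAddCommGroup H] [InnerProductSpace ℂ H]
    [CompleteSpace H] (n : ℕ) {A : H →ₗ.[ℂ] H} (hA : IsSelfAdjoint A)
    (p : TensorPower H n × TensorPower H n) (hp : p ∈ (sumGraph n A).topologicalClosure)
    (h0 : p.1 = 0) : p.2 = 0 := by
  have hsym : ∀ x y : A.domain, inner ℂ (A x) (y : H) = inner ℂ (x : H) (A y) := by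
    have := LinearPMap.adjoint_isFormalAdjoint hA.dense_domain
    rw [LinearPMap.isSelfAdjoint_def.1 hA] at this
    exact this
  have key : ∀ y : Fin n → A.domain, inner ℂ (tprod fun i => (y i : H)) p.2 =
      inner ℂ (∑ k, tprod (Function.update (fun i => (y i : H)) k (A (y k)))) p.1 := by
    intro y
    refine closure_minimal (s := (sumGraph n A : Set (TensorPower H n × TensorPower H n)))
      (t := {p : TensorPower H n × TensorPower H n | inner ℂ (tprod fun i => (y i : H)) p.2 =
      inner ℂ (∑ k, tprod (Function.update (fun i => (y i : H)) k (A (y k)))) p.1}) ?_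
      (isClosed_eq (continuous_const.inner continuous_snd)
        (continuous_const.inner continuous_fst)) hp
    intro q hq
    induction hq using Submodule.span_induction with
    | mem q hq =>
      obtain ⟨x, rfl⟩ := hq
      simp only [Set.mem_ofPred_eq, inner_sum, sum_inner, inner_tprod]
      refine Finset.sum_congr rfl fun k _ => ?_
      refine Finset.prod_congr rfl fun i _ => ?_
      by_cases hik : i = k
      · subst hik
        simp [hsym]
      · simp [hik]
    | zero => simp
    | add a b _ _ ha hb =>
      simp only [Set.mem_ofPred_eq] at ha hb ⊢
      simp only [Prod.snd_add, Prod.fst_add, inner_add_right, ha, hb]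
    | smul c a _ ha =>
      simp only [Set.mem_ofPred_eq] at ha ⊢
      simp only [Prod.smul_snd, Prod.smul_fst, inner_smul_right, ha]
  have hz : ∀ y : Fin n → H, inner ℂ (tprod y) p.2 = 0 := by
    intro y
    have hd : Dense (Set.univ.pi fun _ : Fin n => (A.domain : Set H)) :=
      dense_pi _ fun _ _ => hA.dense_domain
    have hc : IsClosed {y : Fin n → H | inner ℂ (tprod y) p.2 = 0} :=
      isClosed_eq ((continuous_tprod n).inner continuous_const) continuous_const
    refine closure_minimal ?_ hc (hd y)
    intro z hz
    have := key fun i => ⟨z i, hz i trivial⟩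
    rw [h0, inner_zero_right] at this
    exact this
  have : innerSL ℂ p.2 = 0 := clm_ext fun x => by
    rw [innerSL_apply_apply, ← inner_conj_symm, hz]
    simp
  simpa using congrArg (fun L => L p.2) this

theorem secondQuantComp_graph {H : Type*} [NormedAddCommGroup H] [InnerProductSpace ℂ H]
    [CompleteSpace H] (n : ℕ) {A : H →ₗ.[ℂ] H} (hA : IsSelfAdjoint A) :
    (secondQuantComp n A).graph = (sumGraph n A).topologicalClosure.comap
      ((SymTensor H n).subtype.prodMap (SymTensor H n).subtype) := by
  refine Submodule.toLinearPMap_graph_eq _ fun p hp h0 => ?_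
  exact Subtype.ext (sumGraph_closure_functional n hA _ hp (congrArg Subtype.val h0))

section SpinBosonModel

/-- The state space `ℂ²` of the qubit, with `e₁ = (1, 0)` and `e₋₁ = (0, 1)`. -/
abbrev Qubit : Type := EuclideanSpace ℂ (Fin 2)

/-- The Pauli matrix `σ_x`. -/
def pauliX : Qubit →ₗ[ℂ] Qubit := Matrix.toEuclideanLin !![0, 1; 1, 0]

/-- The Pauli matrix `σ_z`. -/
def pauliZ : Qubit →ₗ[ℂ] Qubit := Matrix.toEuclideanLin !![1, 0; 0, -1]

/-- The operator `S ⊗ T`: the closure of the algebraic tensor product of `S` and `T` on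
`ℂ² ⊗ D(T)`. As `ℂ²` is finite dimensional, `ℂ² ⊗ F` needs no completion. -/
def tensorOp {F : Type*} [NormedAddCommGroup F] [InnerProductSpace ℂ F]
    (S : Qubit →ₗ[ℂ] Qubit) (T : F →ₗ.[ℂ] F) : Qubit ⊗[ℂ] F →ₗ.[ℂ] Qubit ⊗[ℂ] F :=
  (Submodule.span ℂ (Set.range fun p : Qubit × T.domain =>
    (p.1 ⊗ₜ[ℂ] (p.2 : F), S p.1 ⊗ₜ[ℂ] T p.2))).topologicalClosure.toLinearPMap

variable {H : Type*} [NormedAddCommGroup H] [InnerProductSpace ℂ H]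

/-- The spin-boson Hamiltonian
`H_η(α, f, ω) = η σ_z ⊗ 1 + 1 ⊗ dΓ(ω) + ∑_{i=1}^{2n} α_i (σ_x ⊗ φ(f_i))ⁱ` on `ℂ² ⊗ F_b(H)`, on its
natural domain. The index `i : Fin (2 * n)` stands for `i + 1`. -/
def spinBosonOp {n : ℕ} (η : ℂ) (α : Fin (2 * n) → ℂ) (f : Fin (2 * n) → H) (ω : H →ₗ.[ℂ] H) :
    Qubit ⊗[ℂ] Fock H →ₗ.[ℂ] Qubit ⊗[ℂ] Fock H :=
  η • tensorOp pauliZ (everywhere LinearMap.id) + tensorOp LinearMap.id (secondQuant ω) +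
    ∑ i, α i • opPow (tensorOp pauliX (fieldOp (f i))) ((i : ℕ) + 1)

/-- The fiber operator `F_η(α, f, ω) = η Γ(-1) + dΓ(ω) + ∑_{i=1}^{2n} α_i φ(f_i)ⁱ` on `F_b(H)`, on
its natural domain. The index `i : Fin (2 * n)` stands for `i + 1`. -/
def fiberOp {n : ℕ} (η : ℂ) (α : Fin (2 * n) → ℂ) (f : Fin (2 * n) → H) (ω : H →ₗ.[ℂ] H) :
    Fock H →ₗ.[ℂ] Fock H :=
  η • gamma (LinearIsometryEquiv.neg ℂ (E := H)).toLinearIsometry + secondQuant ω +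
    ∑ i, α i • opPow (fieldOp (f i)) ((i : ℕ) + 1)

variable (H)

/-- The space `F_b(H) ⊕ F_b(H)` of pairs `(φ₁, φ₋₁)`. -/
abbrev FockPair : Type _ := WithLp 2 (Fock H × Fock H)

variable {H}

/-- The identification `ℂ² ⊗ F ≃ F ⊕ F`, `e₁ ⊗ φ₁ + e₋₁ ⊗ φ₋₁ ↦ (φ₁, φ₋₁)`, as a linear map. -/
def spinMap (F : Type*) [NormedAddCommGroup F] [InnerProductSpace ℂ F] :
    Qubit ⊗[ℂ] F →ₗ[ℂ] WithLp 2 (F × F) :=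
  TensorProduct.lift (LinearMap.mk₂ ℂ (fun v φ => WithLp.toLp 2 (v 0 • φ, v 1 • φ))
    (fun v w φ => by simp [add_smul, ← WithLp.toLp_add])
    (fun c v φ => by simp [mul_smul, ← WithLp.toLp_smul])
    (fun v φ ψ => by simp [← WithLp.toLp_add])
    (fun c v φ => by simp [← WithLp.toLp_smul, smul_comm _ c]))

theorem spinMap_tmul {F : Type*} [NormedAddCommGroup F] [InnerProductSpace ℂ F]
    (v : Qubit) (φ : F) : spinMap F (v ⊗ₜ φ) = WithLp.toLp 2 (v 0 • φ, v 1 • φ) := rfl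

theorem inner_spinMap {F : Type*} [NormedAddCommGroup F] [InnerProductSpace ℂ F]
    (x y : Qubit ⊗[ℂ] F) : inner ℂ (spinMap F x) (spinMap F y) = inner ℂ x y := by
  induction x with
  | zero => simp
  | add a b ha hb => simp only [map_add, inner_add_left, ha, hb]
  | tmul v φ =>
    induction y with
    | zero => simp
    | add a b ha hb => simp only [map_add, inner_add_right, ha, hb]
    | tmul w ψ =>
      simp [spinMap_tmul, WithLp.prod_inner_apply, PiLp.inner_apply, inner_smul_left,
        inner_smul_right]
      ring

theorem spinMap_surjective {F : Type*} [NormedAddCommGroup F] [InnerProductSpace ℂ F] :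
    Function.Surjective (spinMap F) := fun y => by
  refine ⟨EuclideanSpace.single 0 1 ⊗ₜ y.fst + EuclideanSpace.single 1 1 ⊗ₜ y.snd, ?_⟩
  rw [map_add, spinMap_tmul, spinMap_tmul, ← WithLp.toLp_add]
  simp
  rfl

/-- For closable `T` the closure in `tensorOp` is the graph of an operator. -/
theorem tensorOp_graph {F : Type*} [NormedAddCommGroup F] [InnerProductSpace ℂ F]
    (S : Qubit →ₗ[ℂ] Qubit) {T : F →ₗ.[ℂ] F} (hT : T.IsClosable) :
    (tensorOp S T).graph = (Submodule.span ℂ (Set.range fun p : Qubit × T.domain =>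
      (p.1 ⊗ₜ[ℂ] (p.2 : F), S p.1 ⊗ₜ[ℂ] T p.2))).topologicalClosure := by
  refine Submodule.toLinearPMap_graph_eq _ fun p hp h0 => ?_
  let c (s : Fin 2) : Qubit ⊗[ℂ] F →ₗ[ℂ] F :=
    TensorProduct.lift ((LinearMap.lsmul ℂ F).comp (EuclideanSpace.proj s : Qubit →L[ℂ] ℂ).toLinearMap)
  have hc : ∀ s (v : Qubit) (x : F), c s (v ⊗ₜ x) = v s • x := fun s v x => rfl
  have hfst : ∀ x, spinMap F x = WithLp.toLp 2 (c 0 x, c 1 x) := by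
    intro x
    induction x with
    | zero => simp only [map_zero]; rfl
    | tmul v x => rfl
    | add a b ha hb => simp only [map_add, ha, hb, ← WithLp.toLp_add, Prod.mk_add_mk]
  have hcont : ∀ s, Continuous (c s) := by
    have h := ((spinMap F).isometryOfInner inner_spinMap).continuous
    have h0 : Continuous fun x => ((spinMap F x).fst, (spinMap F x).snd) :=
      (WithLp.prod_continuous_ofLp 2 F F).comp h
    intro s
    fin_cases s
    · refine (continuous_fst.comp h0).congr fun x => ?_
      simp [hfst]
    · refine (continuous_snd.comp h0).congr fun x => ?_
      simp [hfst]
  have key : ∀ s, (((S (EuclideanSpace.single 0 1)) s • c 0 p.1 +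
      (S (EuclideanSpace.single 1 1)) s • c 1 p.1, c s p.2) : F × F) ∈ T.closure.graph := by
    intro s
    rw [← hT.graph_closure_eq_closure_graph]
    let L : (Qubit ⊗[ℂ] F) × (Qubit ⊗[ℂ] F) →ₗ[ℂ] F × F :=
      (((S (EuclideanSpace.single 0 1)) s • c 0 + (S (EuclideanSpace.single 1 1)) s • c 1).comp
        (LinearMap.fst ℂ _ _)).prod ((c s).comp (LinearMap.snd ℂ _ _))
    have hLa : ∀ x y, L (x, y) = ((S (EuclideanSpace.single 0 1)) s • c 0 x +
        (S (EuclideanSpace.single 1 1)) s • c 1 x, c s y) := fun x y => rfl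
    have hL : Continuous L :=
      ((((hcont 0).comp continuous_fst).const_smul _).add
        (((hcont 1).comp continuous_fst).const_smul _)).prodMk ((hcont s).comp continuous_snd)
    have hLp : L p ∈ T.graph.topologicalClosure := by
      refine map_mem_closure hL hp ?_
      intro q hq
      induction hq using Submodule.span_induction with
      | mem q hq =>
        obtain ⟨⟨v, x⟩, rfl⟩ := hq
        have hv : v 0 • (EuclideanSpace.single 0 (1 : ℂ) : Qubit) +
            v 1 • (EuclideanSpace.single 1 (1 : ℂ) : Qubit) = v := by
          ext j
          fin_cases j <;> simp
        have e : (S (EuclideanSpace.single 0 1)) s * v 0 + (S (EuclideanSpace.single 1 1)) s * v 1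
            = (S v) s := by
          have := congrArg (fun w => (S w) s) hv
          simp only [map_add, map_smul, PiLp.add_apply, PiLp.smul_apply, smul_eq_mul] at this
          rw [← this]
          ring
        rw [hLa, hc, hc, hc, smul_smul, smul_smul, ← add_smul, e]
        exact T.graph.smul_mem _ (T.mem_graph x)
      | zero => rw [map_zero]; exact zero_mem _
      | add a b _ _ ha hb => rw [map_add]; exact add_mem ha hb
      | smul d a _ ha => rw [map_smul]; exact T.graph.smul_mem _ ha
    exact hLp
  have hz : ∀ s, c s p.2 = 0 := fun s => by
    have := key s
    rw [h0] at this
    simp only [map_zero, smul_zero, add_zero] at this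
    exact T.closure.graph_fst_eq_zero_snd this rfl
  have : spinMap F p.2 = 0 := by rw [hfst, hz, hz]; rfl
  have hn := ((spinMap F).isometryOfInner inner_spinMap).norm_map p.2
  rw [← norm_eq_zero, ← hn]
  simpa using this

/-- The identification `ℂ² ⊗ F ≃ F ⊕ F`, `e₁ ⊗ φ₁ + e₋₁ ⊗ φ₋₁ ↦ (φ₁, φ₋₁)`. -/
def spinEquiv (F : Type*) [NormedAddCommGroup F] [InnerProductSpace ℂ F] :
    Qubit ⊗[ℂ] F ≃ₗᵢ[ℂ] WithLp 2 (F × F) :=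
  LinearIsometryEquiv.ofSurjective ((spinMap F).isometryOfInner inner_spinMap) spinMap_surjective

/-- The Hamiltonian `H_η(α, f, ω)` as an operator on `F_b(H) ⊕ F_b(H)`. -/
def spinBosonOpPair {n : ℕ} (η : ℂ) (α : Fin (2 * n) → ℂ) (f : Fin (2 * n) → H)
    (ω : H →ₗ.[ℂ] H) : FockPair H →ₗ.[ℂ] FockPair H :=
  sandwich (spinEquiv (Fock H)).toLinearEquiv.toLinearMap (spinBosonOp η α f ω)
    (spinEquiv (Fock H)).symm.toLinearEquiv.toLinearMap

/-- The sequence of components that agrees with `φ` for even and with `ψ` for odd particle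
numbers. -/
def evenOdd (φ ψ : Fock H) (k : ℕ) : SymTensor H k := if Even k then φ k else ψ k

end SpinBosonModel

end SpinBoson

end

open SpinBoson

/-! Let `W` be the identification of ℂ² ⊗ F_b with F_b ⊕ F_b followed by the exchange U of the odd
components. Each summand of the Hamiltonian becomes diagonal under `W` for a reason of parity. The
first slot collects even components with spin e₁ and odd components with spin e₋₁, so σ_z acts there
as (-1)^k, that is as Γ(-1), and in the second slot as -Γ(-1). The operator dΓ(ω) preserves the
particle number and does not see the exchange. The operator φ(g) changes the parity of the particle
number while σ_x flips the spin; the two effects cancel, and σ_x ⊗ φ(g) becomes φ(g) ⊕ φ(g).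

Equality of domains comes from arguing with graphs only. `Decomposes` is a statement about graphs,
stable under sums, scalars and powers on natural domains because `W` is bijective, so it suffices to
prove it for the three building blocks: `decomposes_pauliZ`, `decomposes_secondQuant` and
`decomposes_fieldOp`.

The analytic content lies in the closures. `mem_graph_tensorOp` removes the closure in S ⊗ T when S
is an involution and T is closed, which requires dΓ(ω) and φ(g) to be closed. For φ(g), itself a
closure, invariance under the exchange is proved for a(g) + a†(g) and carried to the limit by
continuity. -/

noncomputable section

namespace SpinBoson

/-! ### Calculus of graphs of unbounded operators, and decomposition along a bijection -/

section Graphs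

variable {E F G : Type*} [AddCommGroup E] [Module ℂ E] [AddCommGroup F] [Module ℂ F]
  [AddCommGroup G] [Module ℂ G]

theorem mem_graph_add {S T : E →ₗ.[ℂ] F} {x : E} {y : F} :
    (x, y) ∈ (S + T).graph ↔ ∃ u v, (x, u) ∈ S.graph ∧ (x, v) ∈ T.graph ∧ u + v = y := by
  simp only [LinearPMap.mem_graph_iff]
  constructor
  · rintro ⟨⟨z, hS, hT⟩, rfl, rfl⟩
    exact ⟨_, _, ⟨⟨z, hS⟩, rfl, rfl⟩, ⟨⟨z, hT⟩, rfl, rfl⟩, rfl⟩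
  · rintro ⟨_, _, ⟨⟨z, hS⟩, rfl, rfl⟩, ⟨⟨w, hT⟩, rfl, rfl⟩, rfl⟩
    exact ⟨⟨_, hS, hT⟩, rfl, rfl⟩

/-- The witness `u` cannot be dropped: for `c = 0` the operator still has only the domain of `S`. -/
theorem mem_graph_smul {S : E →ₗ.[ℂ] F} {c : ℂ} {x : E} {y : F} :
    (x, y) ∈ (c • S).graph ↔ ∃ u, (x, u) ∈ S.graph ∧ c • u = y := by
  simp only [LinearPMap.mem_graph_iff]
  constructor
  · rintro ⟨z, rfl, rfl⟩
    exact ⟨_, ⟨z, rfl, rfl⟩, rfl⟩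
  · rintro ⟨_, ⟨z, rfl, rfl⟩, rfl⟩
    exact ⟨z, rfl, rfl⟩

theorem mem_graph_zero {x : E} {y : F} : (x, y) ∈ (0 : E →ₗ.[ℂ] F).graph ↔ y = 0 := by
  simp only [LinearPMap.mem_graph_iff]
  constructor
  · rintro ⟨z, -, rfl⟩
    rfl
  · rintro rfl
    exact ⟨⟨x, trivial⟩, rfl, rfl⟩

theorem mem_graph_everywhere {T : E →ₗ[ℂ] F} {x : E} {y : F} :
    (x, y) ∈ (everywhere T).graph ↔ T x = y := by
  simp only [LinearPMap.mem_graph_iff]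
  constructor
  · rintro ⟨z, rfl, rfl⟩
    rfl
  · rintro rfl
    exact ⟨⟨x, trivial⟩, rfl, rfl⟩

theorem mem_graph_opComp {S : F →ₗ.[ℂ] G} {T : E →ₗ.[ℂ] F} {x : E} {y : G} :
    (x, y) ∈ (opComp S T).graph ↔ ∃ z, (x, z) ∈ T.graph ∧ (z, y) ∈ S.graph := by
  simp only [LinearPMap.mem_graph_iff]
  constructor
  · rintro ⟨⟨w, hT, hS⟩, rfl, rfl⟩
    exact ⟨_, ⟨⟨w, hT⟩, rfl, rfl⟩, ⟨⟨_, hS⟩, rfl, rfl⟩⟩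
  · rintro ⟨_, ⟨⟨w, hT⟩, rfl, rfl⟩, ⟨⟨_, hS⟩, rfl, rfl⟩⟩
    exact ⟨⟨w, hT, hS⟩, rfl, rfl⟩

theorem mem_graph_sandwich {V : E →ₗ[ℂ] F} {T : E →ₗ.[ℂ] E} {W : F →ₗ[ℂ] E} {x y : F} :
    (x, y) ∈ (sandwich V T W).graph ↔ ∃ z, (W x, z) ∈ T.graph ∧ V z = y := by
  simp only [sandwich, mem_graph_opComp, mem_graph_everywhere]
  constructor
  · rintro ⟨z, ⟨_, rfl, h⟩, rfl⟩
    exact ⟨z, h, rfl⟩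
  · rintro ⟨z, h, rfl⟩
    exact ⟨z, ⟨_, rfl, h⟩, rfl⟩

theorem mem_graph_opProd {S : E →ₗ.[ℂ] E} {T : F →ₗ.[ℂ] F} {x y : WithLp 2 (E × F)} :
    (x, y) ∈ (opProd S T).graph ↔ (x.fst, y.fst) ∈ S.graph ∧ (x.snd, y.snd) ∈ T.graph := by
  simp only [LinearPMap.mem_graph_iff]
  constructor
  · rintro ⟨⟨z, hS, hT⟩, rfl, rfl⟩
    exact ⟨⟨⟨_, hS⟩, rfl, rfl⟩, ⟨⟨_, hT⟩, rfl, rfl⟩⟩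
  · rintro ⟨⟨⟨a, hS⟩, h1, h2⟩, ⟨⟨b, hT⟩, h3, h4⟩⟩
    dsimp only at h1 h2 h3 h4
    subst h1 h3
    refine ⟨⟨x, hS, hT⟩, rfl, ?_⟩
    change WithLp.toLp 2 _ = _
    rw [h2, h4]
    rfl

/-- The bijection `W` carries the operator `S` to the direct sum of `A` and `B`. -/
def Decomposes (W : G ≃ₗ[ℂ] WithLp 2 (E × F)) (S : G →ₗ.[ℂ] G) (A : E →ₗ.[ℂ] E)
    (B : F →ₗ.[ℂ] F) : Prop :=
  ∀ x y, (x, y) ∈ S.graph ↔ (W x, W y) ∈ (opProd A B).graph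

namespace Decomposes

variable {W : G ≃ₗ[ℂ] WithLp 2 (E × F)} {S S' : G →ₗ.[ℂ] G} {A A' : E →ₗ.[ℂ] E}
  {B B' : F →ₗ.[ℂ] F}

theorem add (h : Decomposes W S A B) (h' : Decomposes W S' A' B') :
    Decomposes W (S + S') (A + A') (B + B') := by
  intro x y
  simp only [mem_graph_opProd, mem_graph_add, h _ _, h' _ _]
  constructor
  · rintro ⟨u, v, ⟨h1, h2⟩, ⟨h3, h4⟩, rfl⟩
    exact ⟨⟨_, _, h1, h3, by simp⟩, ⟨_, _, h2, h4, by simp⟩⟩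
  · rintro ⟨⟨a, b, h1, h3, e⟩, ⟨c, d, h2, h4, e'⟩⟩
    -- The two slots provide independent splittings; surjectivity of `W` glues them into one
    -- splitting upstairs.
    refine ⟨W.symm (WithLp.toLp 2 (a, c)), W.symm (WithLp.toLp 2 (b, d)),
      by rw [W.apply_symm_apply]; exact ⟨h1, h2⟩, by rw [W.apply_symm_apply]; exact ⟨h3, h4⟩, W.injective ?_⟩
    rw [map_add, W.apply_symm_apply, W.apply_symm_apply, ← WithLp.toLp_add, Prod.mk_add_mk, e, e']
    rfl

theorem smul (h : Decomposes W S A B) (c : ℂ) : Decomposes W (c • S) (c • A) (c • B) := by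
  intro x y
  simp only [mem_graph_opProd, mem_graph_smul, h _ _]
  constructor
  · rintro ⟨u, ⟨h1, h2⟩, rfl⟩
    exact ⟨⟨_, h1, by simp⟩, ⟨_, h2, by simp⟩⟩
  · rintro ⟨⟨a, h1, e⟩, ⟨b, h2, e'⟩⟩
    refine ⟨W.symm (WithLp.toLp 2 (a, b)), by rw [W.apply_symm_apply]; exact ⟨h1, h2⟩, W.injective ?_⟩
    rw [map_smul, W.apply_symm_apply, ← WithLp.toLp_smul, Prod.smul_mk, e, e']
    rfl

theorem zero : Decomposes W 0 0 0 := by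
  intro x y
  simp only [mem_graph_opProd, mem_graph_zero]
  constructor
  · rintro rfl
    simp
  · rintro ⟨h1, h2⟩
    apply W.injective
    rw [map_zero]
    exact WithLp.ofLp_injective 2 (Prod.ext h1 h2)

theorem sum {ι : Type*} (s : Finset ι) {S : ι → G →ₗ.[ℂ] G} {A : ι → E →ₗ.[ℂ] E}
    {B : ι → F →ₗ.[ℂ] F} (h : ∀ i, Decomposes W (S i) (A i) (B i)) :
    Decomposes W (∑ i ∈ s, S i) (∑ i ∈ s, A i) (∑ i ∈ s, B i) := by
  classical
  induction s using Finset.induction_on with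
  | empty => simpa using zero
  | insert i s hi ih =>
    rw [Finset.sum_insert hi, Finset.sum_insert hi, Finset.sum_insert hi]
    exact (h i).add ih

/-- The natural domain of a power asks for a chain of intermediate vectors. A chain for `S` is the
same as a pair of chains for `A` and `B`, again because `W` is onto. -/
theorem opPow (h : Decomposes W S A B) (i : ℕ) :
    Decomposes W (opPow S i) (opPow A i) (opPow B i) := by
  induction i with
  | zero =>
    intro x y
    simp only [SpinBoson.opPow, mem_graph_opProd, mem_graph_everywhere, LinearMap.id_apply]
    constructor
    · rintro rfl
      exact ⟨rfl, rfl⟩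
    · rintro ⟨h1, h2⟩
      exact W.injective (WithLp.ofLp_injective 2 (Prod.ext h1 h2))
  | succ i ih =>
    intro x y
    simp only [SpinBoson.opPow, mem_graph_opProd, mem_graph_opComp, h _ _, ih _ _]
    constructor
    · rintro ⟨z, ⟨h1, h2⟩, ⟨h3, h4⟩⟩
      exact ⟨⟨_, h1, h3⟩, ⟨_, h2, h4⟩⟩
    · rintro ⟨⟨a, h1, h3⟩, ⟨b, h2, h4⟩⟩
      exact ⟨W.symm (WithLp.toLp 2 (a, b)), by rw [W.apply_symm_apply]; exact ⟨h1, h2⟩, by rw [W.apply_symm_apply]; exact ⟨h3, h4⟩⟩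

end Decomposes

end Graphs

/-! ### Operators on ℂ² ⊗ F in terms of their two spin components -/

section TensorOp

variable {F : Type*} [NormedAddCommGroup F] [InnerProductSpace ℂ F]

theorem pauliX_apply (v : Qubit) : pauliX v 0 = v 1 ∧ pauliX v 1 = v 0 := by
  simp [pauliX, Matrix.toLpLin_apply, dotProduct]

theorem pauliZ_apply (v : Qubit) : pauliZ v 0 = v 0 ∧ pauliZ v 1 = -v 1 := by
  simp [pauliZ, Matrix.toLpLin_apply, dotProduct]

theorem spinEquiv_tmul (v : Qubit) (x : F) :
    spinEquiv F (v ⊗ₜ x) = WithLp.toLp 2 (v 0 • x, v 1 • x) := rfl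

theorem spinEquiv_symm_apply (x : WithLp 2 (F × F)) :
    (spinEquiv F).symm x =
      EuclideanSpace.single 0 1 ⊗ₜ x.fst + EuclideanSpace.single 1 1 ⊗ₜ x.snd := by
  rw [LinearIsometryEquiv.symm_apply_eq, map_add, spinEquiv_tmul, spinEquiv_tmul,
    ← WithLp.toLp_add]
  simp
  rfl

/-- In coordinates the map is a sum of two slices `x ↦ v ⊗ x` with fixed `v`. Continuity is needed
to pass to the closure in `mem_graph_tensorOp`. -/
theorem continuous_rTensor_qubit (S : Qubit →ₗ[ℂ] Qubit) : Continuous (S.rTensor F) := by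
  have e : ∀ y, S.rTensor F y = S (EuclideanSpace.single 0 1) ⊗ₜ (spinEquiv F y).fst +
      S (EuclideanSpace.single 1 1) ⊗ₜ (spinEquiv F y).snd := fun y => by
    conv_lhs => rw [← (spinEquiv F).symm_apply_apply y, spinEquiv_symm_apply]
    simp
  have hc : Continuous fun y => WithLp.ofLp (spinEquiv F y) :=
    (WithLp.prod_continuous_ofLp 2 F F).comp (spinEquiv F).continuous
  have h : ∀ v : Qubit, Continuous fun x : F => v ⊗ₜ[ℂ] x := fun v =>
    TensorProduct.continuous_tmul.comp (continuous_const.prodMk continuous_id)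
  rw [show ⇑(S.rTensor F) = _ from funext e]
  exact ((h _).comp (continuous_fst.comp hc)).add ((h _).comp (continuous_snd.comp hc))

/-- The graph of `S ⊗ T`, for an involution `S` and a closed operator `T`. -/
theorem mem_graph_tensorOp {S : Qubit →ₗ[ℂ] Qubit} (hS : S ∘ₗ S = LinearMap.id)
    {T : F →ₗ.[ℂ] F} (hT : T.IsClosed) {x y : Qubit ⊗[ℂ] F} :
    (x, y) ∈ (tensorOp S T).graph ↔
      ((spinEquiv F x).fst, (spinEquiv F (S.rTensor F y)).fst) ∈ T.graph ∧
      ((spinEquiv F x).snd, (spinEquiv F (S.rTensor F y)).snd) ∈ T.graph := by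
  have hSS : ∀ v, S (S v) = v := fun v => congrArg (fun L => L v) hS
  -- Since S ⊗ 1 is its own inverse, y = (S ⊗ T) x means (S ⊗ 1) y = (1 ⊗ T) x, and 1 ⊗ T is T ⊕ T
  -- in spin components.
  have hSSt : ∀ y, S.rTensor F (S.rTensor F y) = y := fun y => by
    rw [← LinearMap.comp_apply, ← LinearMap.rTensor_comp, hS, LinearMap.rTensor_id]
    rfl
  rw [tensorOp_graph S hT.isClosable]
  constructor
  · intro h
    have hc : Continuous fun y => WithLp.ofLp (spinEquiv F y) :=
      (WithLp.prod_continuous_ofLp 2 F F).comp (spinEquiv F).continuous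
    have hc' := hc.comp (continuous_rTensor_qubit (F := F) S)
    -- As `T` is closed, the condition on components is closed, so it is enough to check it on the
    -- generators of the span.
    have hcl : IsClosed {p : (Qubit ⊗[ℂ] F) × (Qubit ⊗[ℂ] F) |
        ((spinEquiv F p.1).fst, (spinEquiv F (S.rTensor F p.2)).fst) ∈ T.graph ∧
        ((spinEquiv F p.1).snd, (spinEquiv F (S.rTensor F p.2)).snd) ∈ T.graph} :=
      (IsClosed.preimage (((continuous_fst.comp hc).comp continuous_fst).prodMk
        ((continuous_fst.comp hc').comp continuous_snd)) hT).inter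
      (IsClosed.preimage (((continuous_snd.comp hc).comp continuous_fst).prodMk
        ((continuous_snd.comp hc').comp continuous_snd)) hT)
    refine closure_minimal ?_ hcl h
    intro q hq
    induction hq using Submodule.span_induction with
    | mem q hq =>
      obtain ⟨⟨v, x⟩, rfl⟩ := hq
      simp only [Set.mem_ofPred_eq, LinearMap.rTensor_tmul, hSS, spinEquiv_tmul]
      exact ⟨T.graph.smul_mem (v 0) (T.mem_graph x), T.graph.smul_mem (v 1) (T.mem_graph x)⟩
    | zero => simp only [Set.mem_ofPred_eq, Prod.fst_zero, Prod.snd_zero, map_zero]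
              exact ⟨zero_mem _, zero_mem _⟩
    | add a b _ _ ha hb =>
      simp only [Set.mem_ofPred_eq, Prod.fst_add, Prod.snd_add, map_add]
      exact ⟨add_mem ha.1 hb.1, add_mem ha.2 hb.2⟩
    | smul d a _ ha =>
      simp only [Set.mem_ofPred_eq, Prod.smul_fst, Prod.smul_snd, map_smul]
      exact ⟨T.graph.smul_mem d ha.1, T.graph.smul_mem d ha.2⟩
  · rintro ⟨h0, h1⟩
    -- No limit is needed here: a pair satisfying the condition is already a sum of two generators,
    -- one for each basis vector of ℂ².
    refine Submodule.le_topologicalClosure _ ?_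
    have ex := (spinEquiv F).symm_apply_apply x
    have ey := congrArg (S.rTensor F) ((spinEquiv F).symm_apply_apply (S.rTensor F y))
    rw [spinEquiv_symm_apply] at ex ey
    rw [hSSt, map_add, LinearMap.rTensor_tmul, LinearMap.rTensor_tmul] at ey
    rw [LinearPMap.mem_graph_iff] at h0 h1
    obtain ⟨a, ha, ha'⟩ := h0
    obtain ⟨b, hb, hb'⟩ := h1
    dsimp only at ha ha' hb hb'
    rw [← ha, ← hb] at ex
    rw [← ha', ← hb'] at ey
    rw [← ex, ← ey, ← Prod.mk_add_mk]
    exact add_mem (Submodule.subset_span ⟨(_, a), rfl⟩) (Submodule.subset_span ⟨(_, b), rfl⟩)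

theorem pauliZ_pauliZ : pauliZ ∘ₗ pauliZ = LinearMap.id := by
  refine LinearMap.ext fun v => PiLp.ext fun i => ?_
  fin_cases i <;> simp [pauliZ_apply]

theorem pauliX_pauliX : pauliX ∘ₗ pauliX = LinearMap.id := by
  refine LinearMap.ext fun v => PiLp.ext fun i => ?_
  fin_cases i <;> simp [pauliX_apply]

theorem spinEquiv_rTensor_pauliX (y : Qubit ⊗[ℂ] F) :
    spinEquiv F (pauliX.rTensor F y) =
      WithLp.toLp 2 ((spinEquiv F y).snd, (spinEquiv F y).fst) := by
  induction y with
  | zero => simp; rfl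
  | tmul v x => simp [spinEquiv_tmul, pauliX_apply]
  | add a b ha hb => simp [ha, hb, ← WithLp.toLp_add]

theorem spinEquiv_rTensor_pauliZ (y : Qubit ⊗[ℂ] F) :
    spinEquiv F (pauliZ.rTensor F y) =
      WithLp.toLp 2 ((spinEquiv F y).fst, -(spinEquiv F y).snd) := by
  induction y with
  | zero => simp; rfl
  | tmul v x => simp [spinEquiv_tmul, pauliZ_apply]
  | add a b ha hb => simp [ha, hb, ← WithLp.toLp_add, add_comm]

theorem isClosed_everywhere_id : (everywhere (LinearMap.id : F →ₗ[ℂ] F)).IsClosed := by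
  have e : ((everywhere (LinearMap.id : F →ₗ[ℂ] F)).graph : Set (F × F)) = {p | p.1 = p.2} :=
    Set.ext fun p => mem_graph_everywhere
  change IsClosed ((everywhere (LinearMap.id : F →ₗ[ℂ] F)).graph : Set (F × F))
  rw [e]
  exact isClosed_eq continuous_fst continuous_snd

theorem mem_graph_pauliZ {x y : Qubit ⊗[ℂ] F} :
    (x, y) ∈ (tensorOp pauliZ (everywhere (LinearMap.id : F →ₗ[ℂ] F))).graph ↔
      (spinEquiv F y).fst = (spinEquiv F x).fst ∧
      (spinEquiv F y).snd = -(spinEquiv F x).snd := by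
  rw [mem_graph_tensorOp pauliZ_pauliZ isClosed_everywhere_id, spinEquiv_rTensor_pauliZ]
  simp only [mem_graph_everywhere, LinearMap.id_apply]
  exact and_congr eq_comm ⟨fun h => by rw [h]; simp, fun h => by rw [h]; simp⟩

theorem mem_graph_pauliX {T : F →ₗ.[ℂ] F} (hT : T.IsClosed) {x y : Qubit ⊗[ℂ] F} :
    (x, y) ∈ (tensorOp pauliX T).graph ↔
      ((spinEquiv F x).fst, (spinEquiv F y).snd) ∈ T.graph ∧
      ((spinEquiv F x).snd, (spinEquiv F y).fst) ∈ T.graph := by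
  rw [mem_graph_tensorOp pauliX_pauliX hT, spinEquiv_rTensor_pauliX]
  rfl

theorem mem_graph_tensorOp_id {T : F →ₗ.[ℂ] F} (hT : T.IsClosed) {x y : Qubit ⊗[ℂ] F} :
    (x, y) ∈ (tensorOp LinearMap.id T).graph ↔
      ((spinEquiv F x).fst, (spinEquiv F y).fst) ∈ T.graph ∧
      ((spinEquiv F x).snd, (spinEquiv F y).snd) ∈ T.graph := by
  rw [mem_graph_tensorOp (LinearMap.id_comp _) hT, LinearMap.rTensor_id, LinearMap.id_apply]

end TensorOp

/-! ### The exchange of odd components as a selfadjoint unitary involution -/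

section EvenOdd

variable {H : Type*} [NormedAddCommGroup H] [InnerProductSpace ℂ H]

theorem memℓp_evenOdd (φ ψ : Fock H) : Memℓp (evenOdd φ ψ) 2 := by
  have h2 : 0 < (2 : ENNReal).toReal := by norm_num
  refine memℓp_gen (((lp.memℓp φ).summable h2).add ((lp.memℓp ψ).summable h2) |>.of_nonneg_of_le
    (fun k => by positivity) fun k => ?_)
  unfold evenOdd
  split_ifs
  · exact le_add_of_nonneg_right (by positivity)
  · exact le_add_of_nonneg_left (by positivity)

/-- The Fock space vector with the even components of `φ` and the odd components of `ψ`. -/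
def evenOddFock (φ ψ : Fock H) : Fock H := ⟨evenOdd φ ψ, memℓp_evenOdd φ ψ⟩

theorem evenOddFock_even (φ ψ : Fock H) {k : ℕ} (hk : Even k) : evenOddFock φ ψ k = φ k :=
  if_pos hk

theorem evenOddFock_odd (φ ψ : Fock H) {k : ℕ} (hk : ¬ Even k) : evenOddFock φ ψ k = ψ k :=
  if_neg hk

/-- Together with `evenOddFock_self` this makes the exchange an involution, and it reduces the
backward halves of later equivalences to the forward ones. -/
theorem evenOddFock_evenOddFock (φ₁ φ₂ ψ₁ ψ₂ : Fock H) :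
    evenOddFock (evenOddFock φ₁ φ₂) (evenOddFock ψ₁ ψ₂) = evenOddFock φ₁ ψ₂ := by
  ext1
  funext k
  by_cases hk : Even k
  · simp only [evenOddFock_even _ _ hk]
  · simp only [evenOddFock_odd _ _ hk]

theorem evenOddFock_self (φ : Fock H) : evenOddFock φ φ = φ := by
  ext1
  funext k
  by_cases hk : Even k
  · simp only [evenOddFock_even _ _ hk]
  · simp only [evenOddFock_odd _ _ hk]

theorem evenOddFock_add (φ φ' ψ ψ' : Fock H) :
    evenOddFock (φ + φ') (ψ + ψ') = evenOddFock φ ψ + evenOddFock φ' ψ' := by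
  ext1
  funext k
  by_cases hk : Even k
  · simp only [evenOddFock_even _ _ hk, lp.coeFn_add, Pi.add_apply]
  · simp only [evenOddFock_odd _ _ hk, lp.coeFn_add, Pi.add_apply]

theorem evenOddFock_smul (c : ℂ) (φ ψ : Fock H) :
    evenOddFock (c • φ) (c • ψ) = c • evenOddFock φ ψ := by
  ext1
  funext k
  by_cases hk : Even k
  · simp only [evenOddFock_even _ _ hk, lp.coeFn_smul, Pi.smul_apply]
  · simp only [evenOddFock_odd _ _ hk, lp.coeFn_smul, Pi.smul_apply]

variable (H) in
/-- The exchange of the odd components of a pair of Fock space vectors, as a linear map. -/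
def parityLinear : FockPair H →ₗ[ℂ] FockPair H where
  toFun φ := WithLp.toLp 2 (evenOddFock φ.fst φ.snd, evenOddFock φ.snd φ.fst)
  map_add' φ ψ := by
    exact congrArg (WithLp.toLp 2) (Prod.ext (evenOddFock_add _ _ _ _) (evenOddFock_add _ _ _ _))
  map_smul' c φ := by
    exact congrArg (WithLp.toLp 2) (Prod.ext (evenOddFock_smul _ _ _) (evenOddFock_smul _ _ _))

theorem parityLinear_parityLinear (φ : FockPair H) : parityLinear H (parityLinear H φ) = φ := by
  change WithLp.toLp 2 (evenOddFock (evenOddFock φ.fst φ.snd) (evenOddFock φ.snd φ.fst),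
    evenOddFock (evenOddFock φ.snd φ.fst) (evenOddFock φ.fst φ.snd)) = φ
  rw [evenOddFock_evenOddFock, evenOddFock_evenOddFock, evenOddFock_self, evenOddFock_self]
  rfl

/-- For each particle number the two inner products on the left are those on the right, in the same
order for even and in the opposite order for odd `k`; summing over `k` gives the symmetry. -/
theorem inner_parityLinear (φ ψ : FockPair H) :
    inner ℂ (parityLinear H φ) ψ = inner ℂ φ (parityLinear H ψ) := by
  change inner ℂ (evenOddFock φ.fst φ.snd) ψ.fst + inner ℂ (evenOddFock φ.snd φ.fst) ψ.snd =
    inner ℂ φ.fst (evenOddFock ψ.fst ψ.snd) + inner ℂ φ.snd (evenOddFock ψ.snd ψ.fst)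
  have h := (lp.hasSum_inner (𝕜 := ℂ) φ.fst (evenOddFock ψ.fst ψ.snd)).add
    (lp.hasSum_inner (𝕜 := ℂ) φ.snd (evenOddFock ψ.snd ψ.fst))
  refine ((lp.hasSum_inner _ _).add (lp.hasSum_inner _ _)).unique (Eq.mpr (congrArg (HasSum · _) (funext fun k => ?_)) h)
  by_cases hk : Even k
  · simp only [evenOddFock_even _ _ hk]
  · simp only [evenOddFock_odd _ _ hk]
    exact add_comm _ _

variable (H) in
/-- The exchange of the odd components of a pair of Fock space vectors. -/
def parityEquiv : FockPair H ≃ₗᵢ[ℂ] FockPair H where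
  __ := LinearEquiv.ofInvolutive (parityLinear H) parityLinear_parityLinear
  norm_map' φ := by
    change ‖parityLinear H φ‖ = ‖φ‖
    -- Symmetry and involutivity give ⟪Uφ, Uφ⟫ = ⟪φ, U²φ⟫ = ⟪φ, φ⟫.
    rw [norm_eq_sqrt_re_inner (𝕜 := ℂ), inner_parityLinear, parityLinear_parityLinear,
      ← norm_eq_sqrt_re_inner]

theorem continuous_fock_apply (k : ℕ) : Continuous fun φ : Fock H => φ k :=
  (lp.evalCLM ℂ (fun n : ℕ => SymTensor H n) 2 k).continuous

/-- This is the first component of the isometry `parityEquiv`. -/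
theorem continuous_evenOddFock :
    Continuous fun p : Fock H × Fock H => evenOddFock p.1 p.2 :=
  continuous_fst.comp ((WithLp.prod_continuous_ofLp 2 _ _).comp ((parityEquiv H).continuous.comp
    (WithLp.prod_continuous_toLp 2 (Fock H) (Fock H))))

end EvenOdd

/-! ### Graphs, closedness and parity behaviour of dΓ(ω), Γ(-1), a(g), a†(g) and φ(g) -/

section FockOperators

variable {H : Type*} [NormedAddCommGroup H] [InnerProductSpace ℂ H]

/-- The square summability in the definition of the domain is automatic, since the image `ψ` is
itself a Fock space vector. Membership in the graph is thereby a purely componentwise condition. -/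
theorem mem_graph_fockDirectSum {T : (n : ℕ) → SymTensor H n →ₗ.[ℂ] SymTensor H n}
    {φ ψ : Fock H} : (φ, ψ) ∈ (fockDirectSum T).graph ↔ ∀ n, (φ n, ψ n) ∈ (T n).graph := by
  simp only [LinearPMap.mem_graph_iff]
  constructor
  · rintro ⟨⟨φ, h, h'⟩, rfl, rfl⟩ n
    exact ⟨⟨_, h n⟩, rfl, rfl⟩
  · intro h
    choose a h1 h2 using h
    have hd : ∀ n, φ n ∈ (T n).domain := fun n => h1 n ▸ (a n).2
    have e : (fun n => T n ⟨φ n, hd n⟩) = ψ := by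
      funext n
      rw [← h2 n]
      congr 1
      exact Subtype.ext (h1 n).symm
    exact ⟨⟨φ, hd, by rw [e]; exact lp.memℓp ψ⟩, rfl, Subtype.ext e⟩

theorem isClosed_fockDirectSum {T : (n : ℕ) → SymTensor H n →ₗ.[ℂ] SymTensor H n}
    (hT : ∀ n, (T n).IsClosed) : (fockDirectSum T).IsClosed := by
  have e : ((fockDirectSum T).graph : Set (Fock H × Fock H)) =
      ⋂ n, {p | (p.1 n, p.2 n) ∈ (T n).graph} :=
    Set.ext fun p => by
      rw [Set.mem_iInter]
      exact mem_graph_fockDirectSum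
  change IsClosed ((fockDirectSum T).graph : Set (Fock H × Fock H))
  rw [e]
  exact isClosed_iInter fun n => IsClosed.preimage
    (((continuous_fock_apply n).comp continuous_fst).prodMk
      ((continuous_fock_apply n).comp continuous_snd)) (hT n)

/-- Selfadjointness of `ω` enters through `secondQuantComp_graph`: it makes the closure of the
algebraic sum an operator graph, so each component is closed. -/
theorem isClosed_secondQuant [CompleteSpace H] {ω : H →ₗ.[ℂ] H} (hω : IsSelfAdjoint ω) :
    (secondQuant ω).IsClosed := by
  refine isClosed_fockDirectSum fun n => ?_
  rw [LinearPMap.IsClosed, secondQuantComp_graph n hω]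
  exact (Submodule.isClosed_topologicalClosure (sumGraph n ω)).preimage
    ((continuous_subtype_val.comp continuous_fst).prodMk
      (continuous_subtype_val.comp continuous_snd))

theorem evenOddFock_mem_graph_fockDirectSum
    {T : (n : ℕ) → SymTensor H n →ₗ.[ℂ] SymTensor H n} {φ φ' ψ ψ' : Fock H}
    (hφ : (φ, φ') ∈ (fockDirectSum T).graph) (hψ : (ψ, ψ') ∈ (fockDirectSum T).graph) :
    (evenOddFock φ ψ, evenOddFock φ' ψ') ∈ (fockDirectSum T).graph := by
  rw [mem_graph_fockDirectSum] at hφ hψ ⊢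
  intro n
  by_cases hn : Even n
  · simpa only [evenOddFock_even _ _ hn] using hφ n
  · simpa only [evenOddFock_odd _ _ hn] using hψ n

theorem gammaComp_neg (n : ℕ) (ψ : SymTensor H n) :
    gammaComp n (LinearIsometryEquiv.neg ℂ (E := H)).toLinearIsometry ψ = (-1 : ℂ) ^ n • ψ := by
  have h : tensorMap n (LinearIsometryEquiv.neg ℂ (E := H)).toLinearIsometry =
      (-1 : ℂ) ^ n • ContinuousLinearMap.id ℂ (TensorPower H n) := by
    refine clm_ext fun x => ?_
    -- The sign is pulled out of each of the `n` factors by multilinearity.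
    have e := (algTprod (H := H) n).map_smul_univ (fun _ => (-1 : ℂ)) x
    rw [tensorMap_tprod]
    simp only [neg_smul, one_smul, Finset.prod_const, Finset.card_univ, Fintype.card_fin] at e
    change ((algTprod n fun i => -x i : AlgTensor H n) : TensorPower H n) = _
    rw [e, UniformSpace.Completion.coe_smul]
    rfl
  exact Subtype.ext (congrArg (fun L => L (ψ : TensorPower H n)) h)

theorem mem_graph_gamma_neg {φ ψ : Fock H} :
    (φ, ψ) ∈ (gamma (LinearIsometryEquiv.neg ℂ (E := H)).toLinearIsometry).graph ↔
      ∀ n, (-1 : ℂ) ^ n • φ n = ψ n := by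
  simp only [gamma, mem_graph_fockDirectSum, mem_graph_everywhere]
  exact forall_congr' fun n => by
    rw [← gammaComp_neg]
    rfl

theorem mem_graph_maximalOp {C : Fock H →ₗ[ℂ] ((n : ℕ) → SymTensor H n)} {φ ψ : Fock H} :
    (φ, ψ) ∈ (maximalOp C).graph ↔ ∀ n, C φ n = ψ n := by
  simp only [LinearPMap.mem_graph_iff]
  constructor
  · rintro ⟨⟨φ, h⟩, rfl, rfl⟩ n
    rfl
  · intro h
    have e : C φ = ψ := funext h
    have hm : Memℓp (C φ) 2 := by rw [e]; exact lp.memℓp ψ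
    exact ⟨⟨φ, hm⟩, rfl, Subtype.ext e⟩

theorem mem_graph_annihilation {g : H} {φ ψ : Fock H} :
    (φ, ψ) ∈ (annihilation g).graph ↔ ∀ n, annihilationComp n g (φ (n + 1)) = ψ n :=
  mem_graph_maximalOp

theorem mem_graph_creation {g : H} {φ ψ : Fock H} :
    (φ, ψ) ∈ (creation g).graph ↔ 0 = ψ 0 ∧ ∀ n, creationComp n g (φ n) = ψ (n + 1) := by
  rw [creation, mem_graph_maximalOp]
  exact ⟨fun h => ⟨h 0, fun n => h (n + 1)⟩, fun h n => by
    cases n with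
    | zero => exact h.1
    | succ n => exact h.2 n⟩

/-- This relation determines `ψ` from `φ` and involves only finitely many components at a time, so
it survives limits. It is one-sided: the sums may be square summable although the annihilation and
creation parts separately are not. -/
theorem mem_graph_annihilation_add_creation {g : H} {φ ψ : Fock H}
    (h : (φ, ψ) ∈ (annihilation g + creation g).graph) :
    ψ 0 = annihilationComp 0 g (φ 1) ∧
      ∀ n, ψ (n + 1) = annihilationComp (n + 1) g (φ (n + 2)) + creationComp n g (φ n) := by
  obtain ⟨u, v, hu, hv, rfl⟩ := mem_graph_add.1 h
  rw [mem_graph_annihilation] at hu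
  rw [mem_graph_creation] at hv
  refine ⟨?_, fun n => ?_⟩
  · exact (congrArg₂ (· + ·) (hu 0).symm hv.1.symm).trans (add_zero _)
  · exact congrArg₂ (· + ·) (hu _).symm (hv.2 n).symm

/-- The closed relation of `mem_graph_annihilation_add_creation` contains the closure of the graph,
and there a vanishing first entry forces the second to vanish. -/
theorem isClosable_annihilation_add_creation (g : H) :
    (annihilation g + creation g).IsClosable := by
  refine ⟨_, (Submodule.toLinearPMap_graph_eq _ fun p hp h0 => ?_).symm⟩
  have hcl : IsClosed {p : Fock H × Fock H | p.2 0 = annihilationComp 0 g (p.1 1) ∧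
      ∀ n, p.2 (n + 1) = annihilationComp (n + 1) g (p.1 (n + 2)) + creationComp n g (p.1 n)} := by
    have h1 : ∀ k, Continuous fun p : Fock H × Fock H => p.1 k := fun k =>
      (continuous_fock_apply k).comp continuous_fst
    have h2 : ∀ k, Continuous fun p : Fock H × Fock H => p.2 k := fun k =>
      (continuous_fock_apply k).comp continuous_snd
    simp only [Set.ofPred_and, Set.ofPred_forall]
    exact (isClosed_eq (h2 0) ((annihilationComp 0 g).continuous.comp (h1 1))).inter
      (isClosed_iInter fun n => isClosed_eq (h2 _)
        (((annihilationComp (n + 1) g).continuous.comp (h1 _)).add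
          ((creationComp n g).continuous.comp (h1 _))))
  have h := closure_minimal (fun q hq => mem_graph_annihilation_add_creation hq) hcl hp
  ext1
  funext k
  cases k with
  | zero =>
    refine h.1.trans ?_
    rw [h0]
    exact map_zero _
  | succ n =>
    refine (h.2 n).trans ?_
    rw [h0]
    exact (congrArg₂ (· + ·) (map_zero _) (map_zero _)).trans (add_zero _)

theorem isClosed_fieldOp (g : H) : (fieldOp g).IsClosed :=
  (isClosable_annihilation_add_creation g).closure_isClosed

/-- The images appear in the opposite order `ψ'`, `φ'` because a(g) changes parity: an even
component of the image is computed from an odd component of the argument. -/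
theorem evenOddFock_mem_graph_annihilation {g : H} {φ φ' ψ ψ' : Fock H}
    (hφ : (φ, φ') ∈ (annihilation g).graph) (hψ : (ψ, ψ') ∈ (annihilation g).graph) :
    (evenOddFock φ ψ, evenOddFock ψ' φ') ∈ (annihilation g).graph := by
  rw [mem_graph_annihilation] at hφ hψ ⊢
  intro n
  by_cases hn : Even n
  · rw [evenOddFock_even _ _ hn, evenOddFock_odd _ _ (by simpa [Nat.even_add_one] using hn)]
    exact hψ n
  · rw [evenOddFock_odd _ _ hn, evenOddFock_even _ _ (by simpa [Nat.even_add_one] using hn)]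
    exact hφ n

theorem evenOddFock_mem_graph_creation {g : H} {φ φ' ψ ψ' : Fock H}
    (hφ : (φ, φ') ∈ (creation g).graph) (hψ : (ψ, ψ') ∈ (creation g).graph) :
    (evenOddFock φ ψ, evenOddFock ψ' φ') ∈ (creation g).graph := by
  rw [mem_graph_creation] at hφ hψ ⊢
  -- The vacuum component is even, hence taken from `ψ'`, where it vanishes as well.
  refine ⟨by rw [evenOddFock_even _ _ Even.zero]; exact hψ.1, fun n => ?_⟩
  by_cases hn : Even n
  · rw [evenOddFock_even _ _ hn, evenOddFock_odd _ _ (by simpa [Nat.even_add_one] using hn)]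
    exact hφ.2 n
  · rw [evenOddFock_odd _ _ hn, evenOddFock_even _ _ (by simpa [Nat.even_add_one] using hn)]
    exact hψ.2 n

/-- Graph membership for φ(g) is known only through a closure, so the property is checked on pairs
from the graph of a(g) + a†(g) and extended by joint continuity of the exchange. -/
theorem evenOddFock_mem_graph_fieldOp {g : H} {φ φ' ψ ψ' : Fock H}
    (hφ : (φ, φ') ∈ (fieldOp g).graph) (hψ : (ψ, ψ') ∈ (fieldOp g).graph) :
    (evenOddFock φ ψ, evenOddFock ψ' φ') ∈ (fieldOp g).graph := by
  rw [fieldOp, ← (isClosable_annihilation_add_creation g).graph_closure_eq_closure_graph]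
    at hφ hψ ⊢
  refine map_mem_closure₂ (f := fun p q : Fock H × Fock H =>
    (evenOddFock p.1 q.1, evenOddFock q.2 p.2)) ?_ hφ hψ ?_
  · exact (continuous_evenOddFock.comp ((continuous_fst.comp continuous_fst).prodMk
      (continuous_fst.comp continuous_snd))).prodMk
      (continuous_evenOddFock.comp ((continuous_snd.comp continuous_snd).prodMk
      (continuous_snd.comp continuous_fst)))
  · rintro ⟨φ, φ'⟩ hφ ⟨ψ, ψ'⟩ hψ
    obtain ⟨u, v, hu, hv, rfl⟩ := mem_graph_add.1 hφ
    obtain ⟨u', v', hu', hv', rfl⟩ := mem_graph_add.1 hψ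
    exact mem_graph_add.2 ⟨_, _, evenOddFock_mem_graph_annihilation hu hu',
      evenOddFock_mem_graph_creation hv hv', (evenOddFock_add _ _ _ _).symm⟩

end FockOperators

/-! ### Diagonalisation of the Hamiltonian by parity -/

section Decomposition

variable {H : Type*} [NormedAddCommGroup H] [InnerProductSpace ℂ H]

variable (H) in
/-- The identification `ℂ² ⊗ F_b(H) ≃ F_b(H) ⊕ F_b(H)` followed by the exchange of the odd
components. -/
def parityDecomposition : Qubit ⊗[ℂ] Fock H ≃ₗ[ℂ] FockPair H :=
  (spinEquiv (Fock H)).toLinearEquiv.trans (parityEquiv H).toLinearEquiv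

theorem parityDecomposition_fst (x : Qubit ⊗[ℂ] Fock H) :
    (parityDecomposition H x).fst = evenOddFock (spinEquiv _ x).fst (spinEquiv _ x).snd := rfl

theorem parityDecomposition_snd (x : Qubit ⊗[ℂ] Fock H) :
    (parityDecomposition H x).snd = evenOddFock (spinEquiv _ x).snd (spinEquiv _ x).fst := rfl

/-- In the first slot even components carry the eigenvalue 1 of σ_z and odd ones -1, which is
(-1)^k; in the second slot the signs are reversed. -/
theorem decomposes_pauliZ :
    Decomposes (parityDecomposition H) (tensorOp pauliZ (everywhere LinearMap.id))
      (gamma (LinearIsometryEquiv.neg ℂ (E := H)).toLinearIsometry)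
      (-(1 : ℂ) • gamma (LinearIsometryEquiv.neg ℂ (E := H)).toLinearIsometry) := by
  intro x y
  rw [mem_graph_opProd, mem_graph_smul, mem_graph_pauliZ, parityDecomposition_fst,
    parityDecomposition_fst, parityDecomposition_snd, parityDecomposition_snd]
  generalize (spinEquiv _ x).fst = φ₁, (spinEquiv _ x).snd = φ₂
  generalize (spinEquiv _ y).fst = ψ₁, (spinEquiv _ y).snd = ψ₂
  have hev : ∀ {k : ℕ}, Even k → (-1 : ℂ) ^ k = 1 := fun h => h.neg_one_pow
  have hod : ∀ {k : ℕ}, ¬ Even k → (-1 : ℂ) ^ k = -1 := fun h =>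
    (Nat.not_even_iff_odd.1 h).neg_one_pow
  constructor
  · rintro ⟨rfl, rfl⟩
    refine ⟨mem_graph_gamma_neg.2 fun k => ?_,
      -- The witness is forced: its negative must be the second slot of the image, whose even
      -- components come from `-φ₂` and odd components from `ψ₁`.
      -evenOddFock (-φ₂) ψ₁, mem_graph_gamma_neg.2 fun k => ?_, by simp⟩
    all_goals
      by_cases hk : Even k
      · simp [evenOddFock_even _ _ hk, hev hk]
      · simp [evenOddFock_odd _ _ hk, hod hk]
  · rintro ⟨h1, u, h2, h3⟩
    rw [mem_graph_gamma_neg] at h1 h2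
    have h3' : ∀ k, -(u k) = evenOddFock ψ₂ ψ₁ k := fun k => by
      rw [← h3, neg_smul, one_smul]
      rfl
    constructor
    all_goals
      ext1
      funext k
      -- For even `k`, `a1` is the equation for spin e₁ and `a2` the one for spin e₋₁; for odd `k`
      -- they trade places.
      have a1 := h1 k
      have a2 := h3' k
      rw [← h2 k] at a2
      by_cases hk : Even k
      · simp only [evenOddFock_even _ _ hk, hev hk, one_smul] at a1 a2
        simp [a1, a2]
      · simp only [evenOddFock_odd _ _ hk, hod hk, neg_smul, one_smul, neg_neg] at a1 a2
        simp [a1, a2]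

theorem decomposes_secondQuant [CompleteSpace H] {ω : H →ₗ.[ℂ] H} (hω : IsSelfAdjoint ω) :
    Decomposes (parityDecomposition H) (tensorOp LinearMap.id (secondQuant ω))
      (secondQuant ω) (secondQuant ω) := by
  intro x y
  rw [mem_graph_opProd, mem_graph_tensorOp_id (isClosed_secondQuant hω),
    parityDecomposition_fst, parityDecomposition_fst, parityDecomposition_snd,
    parityDecomposition_snd]
  constructor
  · rintro ⟨h1, h2⟩
    exact ⟨evenOddFock_mem_graph_fockDirectSum h1 h2, evenOddFock_mem_graph_fockDirectSum h2 h1⟩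
  · rintro ⟨h1, h2⟩
    -- Exchanging a second time restores the original spin components.
    have h3 := evenOddFock_mem_graph_fockDirectSum h1 h2
    have h4 := evenOddFock_mem_graph_fockDirectSum h2 h1
    simp only [evenOddFock_evenOddFock, evenOddFock_self] at h3 h4
    exact ⟨h3, h4⟩

/-- The graph of σ_x ⊗ φ(g) pairs each spin component of `x` with the opposite one of `y`; this is
the crossing in `evenOddFock_mem_graph_fieldOp`, so the slots end up uncrossed. -/
theorem decomposes_fieldOp (g : H) :
    Decomposes (parityDecomposition H) (tensorOp pauliX (fieldOp g)) (fieldOp g)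
      (fieldOp g) := by
  intro x y
  rw [mem_graph_opProd, mem_graph_pauliX (isClosed_fieldOp g), parityDecomposition_fst,
    parityDecomposition_fst, parityDecomposition_snd, parityDecomposition_snd]
  constructor
  · rintro ⟨h1, h2⟩
    exact ⟨evenOddFock_mem_graph_fieldOp h1 h2, evenOddFock_mem_graph_fieldOp h2 h1⟩
  · rintro ⟨h1, h2⟩
    have h3 := evenOddFock_mem_graph_fieldOp h1 h2
    have h4 := evenOddFock_mem_graph_fieldOp h2 h1
    simp only [evenOddFock_evenOddFock, evenOddFock_self] at h3 h4
    exact ⟨h3, h4⟩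

theorem decomposes_spinBosonOp [CompleteSpace H] {n : ℕ} (η : ℂ) (α : Fin (2 * n) → ℂ)
    (f : Fin (2 * n) → H) {ω : H →ₗ.[ℂ] H} (hω : IsSelfAdjoint ω) :
    Decomposes (parityDecomposition H) (spinBosonOp η α f ω) (fiberOp η α f ω)
      (fiberOp (-η) α f ω) := by
  have hz := (decomposes_pauliZ (H := H)).smul η
  -- The factor -1 in the second slot is absorbed into the parameter, which produces the fiber
  -- operator at `-η`.
  rw [smul_smul, mul_neg_one] at hz
  exact (hz.add (decomposes_secondQuant hω)).add
    (Decomposes.sum _ fun i => ((decomposes_fieldOp (f i)).opPow _).smul (α i))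

theorem sandwich_spinBosonOpPair [CompleteSpace H] {n : ℕ} (η : ℂ) (α : Fin (2 * n) → ℂ)
    (f : Fin (2 * n) → H) {ω : H →ₗ.[ℂ] H} (hω : IsSelfAdjoint ω) :
    sandwich (parityLinear H) (spinBosonOpPair η α f ω) (parityLinear H) =
      opProd (fiberOp η α f ω) (fiberOp (-η) α f ω) := by
  refine LinearPMap.eq_of_eq_graph (Submodule.ext fun ⟨φ, ψ⟩ => ?_)
  -- As U is its own inverse, the inverse of `W` is U followed by the inverse identification; the
  -- decomposition is read at these preimages.
  have hW : ∀ χ, parityDecomposition H ((spinEquiv (Fock H)).symm (parityLinear H χ)) = χ :=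
    fun χ => (congrArg (parityLinear H) ((spinEquiv _).apply_symm_apply _)).trans
      (parityLinear_parityLinear χ)
  have h := decomposes_spinBosonOp η α f hω ((spinEquiv (Fock H)).symm (parityLinear H φ))
    ((spinEquiv (Fock H)).symm (parityLinear H ψ))
  rw [hW, hW] at h
  rw [← h, mem_graph_sandwich]
  simp only [spinBosonOpPair, mem_graph_sandwich]
  constructor
  · rintro ⟨_, ⟨z, hz, rfl⟩, rfl⟩
    rw [parityLinear_parityLinear]
    change (_, (spinEquiv (Fock H)).symm (spinEquiv (Fock H) z)) ∈ _
    rw [LinearIsometryEquiv.symm_apply_apply]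
    exact hz
  · intro hz
    exact ⟨_, ⟨_, hz, (spinEquiv _).apply_symm_apply _⟩, parityLinear_parityLinear ψ⟩

end Decomposition

end SpinBoson

end

/-! ### The main theorem -/

theorem mainTheorem2 {H : Type*} [NormedAddCommGroup H] [InnerProductSpace ℂ H] [CompleteSpace H]
    [TopologicalSpace.SeparableSpace H] :
    (∀ φ : FockPair H, Memℓp (evenOdd φ.fst φ.snd) 2 ∧ Memℓp (evenOdd φ.snd φ.fst) 2) ∧
    ∃ U : FockPair H →L[ℂ] FockPair H,
      (∀ (φ : FockPair H) (k : ℕ), (U φ).fst k = evenOdd φ.fst φ.snd k ∧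
        (U φ).snd k = evenOdd φ.snd φ.fst k) ∧
      IsSelfAdjoint U ∧ U ∈ unitary (FockPair H →L[ℂ] FockPair H) ∧
      ∀ (n : ℕ) (η : ℂ) (α : Fin (2 * n) → ℂ) (f : Fin (2 * n) → H) (ω : H →ₗ.[ℂ] H),
        IsSelfAdjoint ω →
        sandwich U.toLinearMap (spinBosonOpPair η α f ω) (U.adjoint).toLinearMap =
          opProd (fiberOp η α f ω) (fiberOp (-η) α f ω) := by
  let U : FockPair H →L[ℂ] FockPair H := (parityEquiv H).toContinuousLinearEquiv
  have hU : IsSelfAdjoint U :=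
    ContinuousLinearMap.isSelfAdjoint_iff_isSymmetric.2 inner_parityLinear
  -- With U* = U, the identity U² = 1 is both halves of unitarity.
  have hUU : U * U = 1 := ContinuousLinearMap.ext parityLinear_parityLinear
  refine ⟨fun φ => ⟨memℓp_evenOdd _ _, memℓp_evenOdd _ _⟩, U, fun φ k => ⟨rfl, rfl⟩, hU, ?_, ?_⟩
  · rw [Unitary.mem_iff, hU.star_eq]
    exact ⟨hUU, hUU⟩
  · intro n η α f ω hω
    have hadj : U.adjoint = U := hU.star_eq
    rw [hadj]
    exact sandwich_spinBosonOpPair η α f hω
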